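/- Let $M\subseteq\mathbb R^3$ be a smoothly embedded $3$-manifold (of codimension zero) with possibly empty boundary $\partial M$ and without corners, and let $\mathcal O_3=O(3)/\mathcal B_3$ be the space of undirected orthonormal $3$-frames, where $\mathcal B_3$ is the group of the $48$ signed permutation matrices acting by right multiplication (permuting and reflecting the columns). A ($3$-)frame field on $M$ with set of singularities $\mathcal S\subseteq M$ is a continuous map $f\colon M\setminus\mathcal S\to\mathcal O_3$; it is boundary aligned if at each point of $\partial M$ where it is defined one of the axes of the frame is normal to $\partial M$. For $C\subseteq M$ let $\mathrm{Int}_M(C)$ be the interior of $C$ as a subspace of $M$, and let $\mathrm{Int}(C)$ and $\partial C$ be the interior and boundary of $C$ as a subspace of $\mathbb R^3$ (for $C=M$, $\partial M$ is the manifold boundary). A set $P\subseteq\mathcal S$ is redundant via a closed subspace $C$ of $M$ if $P\subseteq\mathrm{Int}_M(C)$ and there is a continuous map $f'\colon(M\setminus\mathcal S)\cup\mathrm{Int}_M(C)\to\mathcal O_3$ that agrees with $f$ on $(M\setminus\mathcal S)\setminus\mathrm{Int}_M(C)$ and is boundary aligned if $f$ is. It is redundant if it is redundant via some closed subspace of $M$.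 Let $f$ be a frame field on $M$ with set of singularities $\mathcal S$, let $B\subseteq M$ be a closed $3$-ball (a subspace homeomorphic to the closed unit ball of $\mathbb R^3$) such that $\partial B$ contains at most one point of $\mathcal S$, and let $P\subseteq\mathcal S$ be contained in $\mathrm{Int}(B)$. If $f$ is boundary aligned and $\mathrm{Int}_M(B)\cap\partial B$ contains a point of $\mathcal S$ (which then lies on $\partial M$), assume also that $\mathcal S$ is closed in $M$. Then $P$ is redundant; in fact it is redundant via some closed $C\subseteq B$. -/

import Mathlib

open Set Topology
open scoped ContDiff

namespace FrameField

/-- Euclidean `n`-space. -/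
abbrev E (n : ℕ) : Type := EuclideanSpace ℝ (Fin n)

/-- The orthogonal group `O(n)`; the columns of a matrix are the vectors of an orthonormal
`n`-frame. -/
abbrev O (n : ℕ) : Type := Matrix.orthogonalGroup (Fin n) ℝ

/-- The full hyperoctahedral group: the orthogonal matrices obtained from the identity matrix by
permuting and reflecting columns, i.e. the `j`-th column is `ε j` times the basis vector
`e_{σ j}`. -/
def hyperoctahedral (n : ℕ) : Subgroup (O n) where
  carrier := {A | ∃ (σ : Equiv.Perm (Fin n)) (ε : Fin n → ℤˣ),
    ∀ i j, A.1 i j = if i = σ j then ((ε j : ℤ) : ℝ) else 0}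
  one_mem' := ⟨1, 1, fun i j => by simp [Matrix.one_apply]⟩
  mul_mem' := by
    rintro A B ⟨σ, ε, hA⟩ ⟨τ, δ, hB⟩
    refine ⟨σ * τ, fun j => ε (τ j) * δ j, fun i j => ?_⟩
    have h : (A * B).1 i j = ∑ k, A.1 i k * B.1 k j := rfl
    rw [h]
    simp only [hA, hB]
    rw [Finset.sum_eq_single (τ j)]
    · by_cases hi : i = σ (τ j) <;> simp [hi]
    · intro k _ hk
      simp [hk]
    · simp
  inv_mem' := by
    rintro A ⟨σ, ε, hA⟩
    refine ⟨σ⁻¹, fun j => ε (σ⁻¹ j), fun i j => ?_⟩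
    have h : (A⁻¹).1 i j = A.1 j i := rfl
    rw [h, hA]
    by_cases hi : j = σ i
    · simp [hi]
    · have hi' : i ≠ σ⁻¹ j := by
        rintro rfl
        simp at hi
      rw [if_neg hi, if_neg hi']

/-- The space of undirected orthonormal `n`-frames in `ℝⁿ`: orthonormal frames up to permuting and
reflecting their axes, i.e. the orbit space of `O(n)` under right multiplication by the
hyperoctahedral group, with the quotient topology. -/
abbrev Frame (n : ℕ) : Type := O n ⧸ hyperoctahedral n

/-- `M ⊆ ℝⁿ` is a smoothly embedded `n`-manifold with (possibly empty) boundary and without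
corners: near each of its points, `M` is either all of `ℝⁿ` or a smooth half-space
`{0 ≤ g}` with `dg ≠ 0`. -/
def IsSmoothDomain {n : ℕ} (M : Set (E n)) : Prop :=
  ∀ p ∈ M, p ∈ interior M ∨
    ∃ (U : Set (E n)) (g : E n → ℝ), IsOpen U ∧ p ∈ U ∧ ContDiffOn ℝ ∞ g U ∧
      g p = 0 ∧ fderiv ℝ g p ≠ 0 ∧ M ∩ U = {x ∈ U | 0 ≤ g x}

/-- The boundary `∂M` of a codimension-zero submanifold `M ⊆ ℝⁿ`. -/
def bdry {n : ℕ} (M : Set (E n)) : Set (E n) := M \ interior M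

/-- `w` is tangent at `x` to `X`: it is the velocity of a curve in `X` through `x`. -/
def IsTangentAt {n : ℕ} (X : Set (E n)) (x w : E n) : Prop :=
  ∃ γ : ℝ → E n, (∀ t, γ t ∈ X) ∧ γ 0 = x ∧ HasDerivAt γ w 0

/-- One of the axes of the undirected frame `q` is orthogonal to the tangent plane at `x`
of `∂M`. -/
def HasNormalAxis {n : ℕ} (M : Set (E n)) (x : E n) (q : Frame n) : Prop :=
  ∃ A : O n, (A : Frame n) = q ∧ ∃ j : Fin n,
    ∀ w : E n, IsTangentAt (bdry M) x w → ∑ i, A.1 i j * w i = 0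

/-- A frame field `f` on `M` with singularity set `S`: a continuous map from `M \ S` to the space
of undirected frames. (Only the values of `f` on `M \ S` matter.) -/
def IsFrameField {n : ℕ} (M S : Set (E n)) (f : E n → Frame n) : Prop :=
  ContinuousOn f (M \ S)

/-- `f`, considered on `N ⊆ M`, is boundary aligned: wherever it is defined on `∂M`, one of its
axes is normal to `∂M`. -/
def BoundaryAligned {n : ℕ} (M N : Set (E n)) (f : E n → Frame n) : Prop :=
  ∀ x ∈ bdry M ∩ N, HasNormalAxis M x (f x)

/-- The interior of `C` as a subspace of `M`. -/
def relInterior {n : ℕ} (M C : Set (E n)) : Set (E n) :=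
  (Subtype.val : M → E n) '' interior ((Subtype.val : M → E n) ⁻¹' C)

/-- `C` is a closed subspace of `M`. -/
def IsClosedIn {n : ℕ} (M C : Set (E n)) : Prop :=
  C ⊆ M ∧ IsClosed ((Subtype.val : M → E n) ⁻¹' C)

/-- The closed subspace `C` of `M` shows that the set `P` of singularities of `f` is redundant:
`P` lies in the interior of `C` in `M`, and `f` can be redefined on that interior, without any
singularity there, keeping it boundary aligned if it was. -/
def RedundantVia {n : ℕ} (M S : Set (E n)) (f : E n → Frame n) (P C : Set (E n)) : Prop :=
  IsClosedIn M C ∧ P ⊆ relInterior M C ∧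
    ∃ f' : E n → Frame n,
      ContinuousOn f' ((M \ S) ∪ relInterior M C) ∧
      EqOn f' f ((M \ S) \ relInterior M C) ∧
      (BoundaryAligned M (M \ S) f → BoundaryAligned M ((M \ S) ∪ relInterior M C) f')

/-- The set `P` of singularities of the frame field `f` is redundant. -/
def Redundant {n : ℕ} (M S : Set (E n)) (f : E n → Frame n) (P : Set (E n)) : Prop :=
  ∃ C : Set (E n), RedundantVia M S f P C

/-- `B` is a closed `n`-ball, i.e. it is homeomorphic to the closed unit ball of `ℝⁿ`. -/
def IsClosedBall {n : ℕ} (B : Set (E n)) : Prop :=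
  Nonempty (B ≃ₜ Metric.closedBall (0 : E n) 1)

end FrameField

/-!
Choose a homeomorphism between the ball `B` and the closed unit ball. By
`mem_interior_iff_norm_lt_one` it maps the frontier of `B` in space onto the unit sphere; this is
invariance of domain, obtained from Brouwer's theorem and thus from the fact that the ball does not
retract onto the sphere (`not_contDiffAt_retraction_sphere`). The frontier of `B` contains all
points of `B` outside its interior relative to `M`, and all points of `∂M` in `B`. So a frame field
on `B` that agrees with `f` on the frontier can be glued to `f`, and it stays boundary aligned
(`FrameField.redundantVia_of_eq_on_boundary`). There are four cases.

* There is no singularity on the frontier of `B`. The space of undirected frames is covered by the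
  sphere `S³` of unit quaternions (`FrameField.isCoveringMap_frameOfQuaternion`). The restriction of
  `f` to the frontier, a map from `S²`, lifts to `S³` (`IsCoveringMap.exists_lift_sphere`). Since
  `π₂ S³ = 0`, the lift extends to the ball (`ContinuousOn.exists_extension_norm_eq_one`).
* There is one singularity `y₀` on the frontier, outside the relative interior of `B`. The frontier
  without `y₀` is homeomorphic to a plane, hence a retract of `B` without `y₀`
  (`exists_continuousOn_mapsTo_sphere_sdiff_singleton`); compose `f` with the retraction.
* The singularity `y₀` is in the relative interior of `B`, and `f` is not boundary aligned. A new
  field may then take any value at `y₀` and on the nearby frontier. The part of `B` outside the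
  relative interior is compact and lies in the frontier without `y₀`, so its inclusion into the
  latter extends to a map on all of `B`; compose `f` with it.
* The singularity `y₀` is in the relative interior of `B`, and `f` is boundary aligned. Now `f` has
  to be kept on the frontier, and `y₀` remains singular. As the set of singularities is closed, the
  singularities in `B` other than `y₀` keep away from the frontier except near `y₀`, so there is a
  closed `C ⊆ B` that contains them in its interior and meets the frontier in `y₀` only. A map that
  is the identity near the frontier pushes `B` without `y₀` off the singularities
  (`exists_push_off_of_isClosed`); compose `f` with it.
-/

/-! ### The ball does not retract onto the sphere -/

section NoRetraction

variable {V : Type*} [NormedAddCommGroup V] [InnerProductSpace ℝ V] [FiniteDimensional ℝ V]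

open Polynomial in
/-- The function `t ↦ det (1 + t A)` is a polynomial of degree at most the dimension. -/
lemma exists_polynomial_eval_eq_det_one_add_smul (A : V →L[ℝ] V) :
    ∃ p : ℝ[X], p.natDegree ≤ Module.finrank ℝ V ∧
      ∀ t : ℝ, p.eval t = ((1 : V →L[ℝ] V) + t • A).det := by
  let b := Module.finBasis ℝ V
  let M := LinearMap.toMatrix b b (A : V →ₗ[ℝ] V)
  refine ⟨((X : ℝ[X]) • M.map C + (1 : Matrix _ _ ℝ).map C).det, ?_, fun t => ?_⟩
  · simpa using natDegree_det_X_add_C_le M 1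
  · have h := RingHom.map_det (evalRingHom t) ((X : ℝ[X]) • M.map C + (1 : Matrix _ _ ℝ).map C)
    rw [coe_evalRingHom] at h
    rw [h, ContinuousLinearMap.det, ← LinearMap.det_toMatrix b]
    congr 1
    ext i j
    rcases eq_or_ne i j with rfl | hij
    · simp only [RingHom.mapMatrix_apply, Matrix.map_apply, Matrix.add_apply, Matrix.smul_apply,
        coe_evalRingHom, Matrix.one_apply_eq, smul_eq_mul, eval_add, eval_mul, eval_X, eval_C, M,
        LinearMap.toMatrix_apply]
      simp [add_comm]
    · simp only [RingHom.mapMatrix_apply, Matrix.map_apply, Matrix.add_apply, Matrix.smul_apply,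
        coe_evalRingHom, Matrix.one_apply_ne hij, smul_eq_mul, eval_add, eval_mul, eval_X, eval_C,
        M, LinearMap.toMatrix_apply]
      simp [hij.symm]

/-- `det (1 + A)` is recovered by Lagrange interpolation from the values of `det (1 + t A)` at
any `dim V + 1` distinct nodes, with weights that do not depend on `A`. -/
lemma det_one_add_eq_sum {v : ℕ → ℝ} (hv : Function.Injective v) (A : V →L[ℝ] V) :
    ((1 : V →L[ℝ] V) + A).det = ∑ i ∈ Finset.range (Module.finrank ℝ V + 1),
      (Lagrange.basis (Finset.range (Module.finrank ℝ V + 1)) v i).eval 1 *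
        ((1 : V →L[ℝ] V) + v i • A).det := by
  obtain ⟨p, hp, he⟩ := exists_polynomial_eval_eq_det_one_add_smul A
  have hd : p.degree < (Finset.range (Module.finrank ℝ V + 1)).card := by
    rw [Finset.card_range]
    exact lt_of_le_of_lt Polynomial.degree_le_natDegree (by exact_mod_cast Nat.lt_succ_of_le hp)
  have h := congrArg (Polynomial.eval 1)
    (Lagrange.eq_interpolate (s := Finset.range (Module.finrank ℝ V + 1)) hv.injOn hd)
  rw [he, one_smul, Lagrange.interpolate_apply, Polynomial.eval_finsetSum] at h
  rw [h]
  refine Finset.sum_congr rfl fun i _ => ?_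
  rw [Polynomial.eval_mul, Polynomial.eval_C, he, mul_comm]

/-- If `t ‖A‖ < 1` then `1 + s A` is invertible for all `s ∈ [0, t]`, so `det (1 + t A)` has the
sign of `det 1`. -/
lemma det_one_add_smul_pos {A : V →L[ℝ] V} {t : ℝ} (ht : 0 ≤ t) (hA : t * ‖A‖ < 1) :
    0 < ((1 : V →L[ℝ] V) + t • A).det := by
  obtain ⟨p, -, he⟩ := exists_polynomial_eval_eq_det_one_add_smul A
  have h0 : p.eval 0 = 1 := by rw [he]; simp [ContinuousLinearMap.det]
  have hne : ∀ s ∈ Icc 0 t, p.eval s ≠ 0 := by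
    intro s hs h
    rw [he, ContinuousLinearMap.det] at h
    obtain ⟨v, hv, hv0⟩ := (Submodule.ne_bot_iff _).1 (LinearMap.bot_lt_ker_of_det_eq_zero h).ne'
    have h1 : v + s • A v = 0 := by simpa using hv
    have h2 : ‖v‖ = s * ‖A v‖ := by
      conv_lhs => rw [eq_neg_of_add_eq_zero_left h1]
      rw [norm_neg, norm_smul, Real.norm_of_nonneg hs.1]
    have h3 : s * ‖A v‖ ≤ t * (‖A‖ * ‖v‖) :=
      mul_le_mul hs.2 (A.le_opNorm v) (norm_nonneg _) ht
    have h4 : 0 < ‖v‖ := norm_pos_iff.2 hv0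
    nlinarith
  rw [← he]
  by_contra hcon
  obtain ⟨s, hs, hs0⟩ := intermediate_value_Icc' ht p.continuous.continuousOn
    (show (0 : ℝ) ∈ Icc (p.eval t) (p.eval 0) from ⟨not_lt.1 hcon, by simp [h0]⟩)
  exact hne s hs hs0

omit [FiniteDimensional ℝ V] in
/-- A function that is Lipschitz on the closed unit ball and vanishes on the unit sphere stays
Lipschitz when it is extended by zero. -/
lemma LipschitzOnWith.extend_zero_closedBall {g : V → V} {K : NNReal}
    (hg : LipschitzOnWith K g (Metric.closedBall 0 1)) (hs : ∀ x, ‖x‖ = 1 → g x = 0)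
    (ho : ∀ x, 1 < ‖x‖ → g x = 0) : LipschitzWith K g := by
  have key : ∀ x y, ‖x‖ ≤ 1 → 1 < ‖y‖ → dist (g x) (g y) ≤ K * dist x y := by
    intro x y hx hy
    have hc : ContinuousOn (fun s : ℝ => ‖AffineMap.lineMap x y s‖) (Icc 0 1) := by
      have := (AffineMap.lineMap_continuous (p := x) (q := y) (R := ℝ)).norm
      exact this.continuousOn
    obtain ⟨s, hs01, hs1⟩ := intermediate_value_Icc zero_le_one hc
      (show (1 : ℝ) ∈ Icc _ _ by simp [hx, hy.le])
    have h1 := hg.dist_le_mul x (by simpa using hx) (AffineMap.lineMap x y s)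
      (by simpa using hs1.le)
    rw [hs _ hs1] at h1
    rw [ho _ hy]
    refine h1.trans (mul_le_mul_of_nonneg_left ?_ K.2)
    rw [dist_left_lineMap, Real.norm_of_nonneg hs01.1]
    exact mul_le_of_le_one_left dist_nonneg hs01.2
  refine LipschitzWith.of_dist_le_mul fun x y => ?_
  rcases le_or_gt ‖x‖ 1 with hx | hx <;> rcases le_or_gt ‖y‖ 1 with hy | hy
  · exact hg.dist_le_mul x (by simpa using hx) y (by simpa using hy)
  · exact key x y hx hy
  · rw [dist_comm, dist_comm x]
    exact key y x hy hx
  · rw [ho _ hx, ho _ hy, dist_self]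
    positivity

/-- If `g` is `K`-Lipschitz and vanishes off the open unit ball, then `id + t g` is a bijection of
the space for `0 ≤ t < 1 / K`, and maps the open unit ball onto itself. -/
lemma injective_and_image_ball_eq_of_lipschitzWith {g : V → V} {K : NNReal}
    (hg : LipschitzWith K g) (hg0 : ∀ x, 1 ≤ ‖x‖ → g x = 0) {t : NNReal} (ht : t * K < 1) :
    Function.Injective (fun x => x + t • g x) ∧
      (fun x => x + t • g x) '' Metric.ball 0 1 = Metric.ball 0 1 := by
  set F : V → V := fun x => x + t • g x with hF
  have happ : ApproximatesLinearOn F (ContinuousLinearEquiv.refl ℝ V : V →L[ℝ] V) univ (t * K) := by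
    rw [ApproximatesLinearOn.approximatesLinearOn_iff_lipschitzOnWith, lipschitzOnWith_univ]
    have : F - ⇑(ContinuousLinearEquiv.refl ℝ V : V →L[ℝ] V) = fun x => t • g x := by
      ext x
      simp [hF]
    rw [this]
    refine LipschitzWith.of_dist_le_mul fun x y => ?_
    rw [NNReal.smul_def, NNReal.smul_def, dist_smul₀, NNReal.coe_mul, mul_assoc,
      Real.norm_of_nonneg t.coe_nonneg]
    exact mul_le_mul_of_nonneg_left (hg.dist_le_mul x y) t.2
  have hc : Subsingleton V ∨
      t * K < ‖((ContinuousLinearEquiv.refl ℝ V).symm : V →L[ℝ] V)‖₊⁻¹ := by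
    rcases subsingleton_or_nontrivial V with h | h
    · exact Or.inl h
    · right
      have : ‖((ContinuousLinearEquiv.refl ℝ V).symm : V →L[ℝ] V)‖₊ = 1 := by
        ext
        exact ContinuousLinearMap.norm_id
      rw [this, inv_one]
      exact ht
  have hinj : Function.Injective F := injOn_univ.1 (happ.injOn hc)
  have hsurj : Function.Surjective F := happ.surjective hc
  have hid : ∀ x, x ∉ Metric.ball (0 : V) 1 → F x = x := by
    intro x hx
    simp [hF, hg0 x (by simpa using hx)]
  refine ⟨hinj, Subset.antisymm ?_ fun y hy => ?_⟩
  · rintro _ ⟨x, hx, rfl⟩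
    by_contra hn
    exact hn (by rwa [hinj (hid _ hn)])
  · obtain ⟨x, rfl⟩ := hsurj y
    by_cases hx : x ∈ Metric.ball (0 : V) 1
    · exact ⟨x, hx, rfl⟩
    · exact absurd (hid x hx ▸ hy) hx

open MeasureTheory in
/-- There is no `C¹` retraction of the closed unit ball onto the unit sphere. For such an `f`, the
volume of the image of the ball under `id + t (f - id)` is the integral of `det (1 + t (Df - 1))`,
a polynomial in `t`; for small `t` it is the volume of the ball, while at `t = 1` the integrand
vanishes because the values of `f` have constant norm. -/
theorem not_contDiffAt_retraction_sphere {f : V → V}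
    (hf : ∀ x ∈ Metric.closedBall (0 : V) 1, ContDiffAt ℝ 1 f x)
    (hn : ∀ x ∈ Metric.closedBall (0 : V) 1, ‖f x‖ = 1) (hs : ∀ x, ‖x‖ = 1 → f x = x) : False := by
  classical
  let : MeasurableSpace V := borel V
  have : BorelSpace V := ⟨rfl⟩
  let g : V → V := fun x => if ‖x‖ ≤ 1 then f x - x else 0
  have hg0 : ∀ x, 1 ≤ ‖x‖ → g x = 0 := by
    intro x hx
    by_cases h : ‖x‖ ≤ 1
    · simp [g, hs x (le_antisymm h hx)]
    · simp [g, h]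
  obtain ⟨K, hK⟩ : ∃ K, LipschitzWith K g := by
    have h1 : LocallyLipschitzOn (Metric.closedBall (0 : V) 1) fun x => f x - x := by
      intro x hx
      obtain ⟨K, t, ht, hl⟩ := ((hf x hx).sub contDiffAt_id).exists_lipschitzOnWith
      exact ⟨K, t, mem_nhdsWithin_of_mem_nhds ht, hl⟩
    obtain ⟨K, hK⟩ := h1.exists_lipschitzOnWith_of_compact (isCompact_closedBall 0 1)
    refine ⟨K, LipschitzOnWith.extend_zero_closedBall (fun x hx y hy => ?_)
      (fun x hx => hg0 x hx.ge) (fun x hx => hg0 x hx.le)⟩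
    have hx' : ‖x‖ ≤ 1 := by simpa using hx
    have hy' : ‖y‖ ≤ 1 := by simpa using hy
    simpa only [g, hx', hy', if_true] using hK hx hy
  let A : V → V →L[ℝ] V := fun x => fderiv ℝ g x
  have hgf : ∀ x ∈ Metric.ball (0 : V) 1, g =ᶠ[𝓝 x] fun y => f y - y := by
    intro x hx
    filter_upwards [Metric.isOpen_ball.mem_nhds hx] with y hy
    have : ‖y‖ ≤ 1 := by simpa using (Metric.ball_subset_closedBall hy)
    simp [g, this]
  have hfd : ∀ x ∈ Metric.ball (0 : V) 1, DifferentiableAt ℝ f x := fun x hx =>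
    (hf x (Metric.ball_subset_closedBall hx)).differentiableAt (by simp)
  have hgd : ∀ x ∈ Metric.ball (0 : V) 1, HasFDerivAt g (A x) x := fun x hx =>
    (((hfd x hx).sub differentiableAt_id).congr_of_eventuallyEq (hgf x hx)).hasFDerivAt
  have hA : ∀ x ∈ Metric.ball (0 : V) 1, fderiv ℝ f x = 1 + A x := by
    intro x hx
    have h1 : A x = fderiv ℝ f x - 1 := by
      have : A x = fderiv ℝ (fun y => f y - y) x := (hgf x hx).fderiv_eq
      rw [this, fderiv_fun_sub (hfd x hx) differentiableAt_fun_id, fderiv_fun_id]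
      rfl
    rw [h1]
    abel
  -- At `t = 1` the derivative is degenerate: its image is orthogonal to `f x`.
  have hdet : ∀ x ∈ Metric.ball (0 : V) 1, ((1 : V →L[ℝ] V) + A x).det = 0 := by
    intro x hx
    rw [← hA x hx]
    by_contra hne
    have horth : ∀ v, inner ℝ (f x) (fderiv ℝ f x v) = 0 := by
      have hc : (fun y => inner ℝ (f y) (f y)) =ᶠ[𝓝 x] fun _ => (1 : ℝ) := by
        filter_upwards [Metric.isOpen_ball.mem_nhds hx] with y hy
        rw [real_inner_self_eq_norm_sq, hn y (Metric.ball_subset_closedBall hy), one_pow]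
      have h1 := hc.fderiv_eq (𝕜 := ℝ)
      intro v
      have h2 := fderiv_inner_apply ℝ (hfd x hx) (hfd x hx) v
      rw [h1, real_inner_comm (f x)] at h2
      simp at h2
      linarith
    have hsurj : Function.Surjective (fderiv ℝ f x) := by
      have hu : IsUnit (LinearMap.det (fderiv ℝ f x : V →ₗ[ℝ] V)) := isUnit_iff_ne_zero.2 hne
      intro y
      obtain ⟨v, hv⟩ := (LinearMap.equivOfIsUnitDet hu).surjective y
      exact ⟨v, by rwa [LinearMap.equivOfIsUnitDet_apply] at hv⟩
    obtain ⟨v, hv⟩ := hsurj (f x)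
    have h0 := horth v
    rw [hv, real_inner_self_eq_norm_sq, hn x (Metric.ball_subset_closedBall hx)] at h0
    norm_num at h0
  -- For small `t` the integral of the determinant is the volume of the ball.
  have hsmall : ∀ t : NNReal, t * K < 1 →
      IntegrableOn (fun x => ((1 : V →L[ℝ] V) + (t : ℝ) • A x).det) (Metric.ball (0 : V) 1) volume ∧
      ∫ x in Metric.ball (0 : V) 1, ((1 : V →L[ℝ] V) + (t : ℝ) • A x).det =
        volume.real (Metric.ball (0 : V) 1) := by
    intro t ht
    obtain ⟨hinj, himg⟩ := injective_and_image_ball_eq_of_lipschitzWith hK hg0 ht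
    have hder : ∀ x ∈ Metric.ball (0 : V) 1, HasFDerivWithinAt (fun x => x + t • g x)
        ((1 : V →L[ℝ] V) + (t : ℝ) • A x) (Metric.ball 0 1) x := fun x hx =>
      ((hasFDerivAt_id x).add ((hgd x hx).const_smul (t : ℝ))).hasFDerivWithinAt
    have hpos : ∀ x ∈ Metric.ball (0 : V) 1,
        |((1 : V →L[ℝ] V) + (t : ℝ) • A x).det| • (1 : ℝ) =
          ((1 : V →L[ℝ] V) + (t : ℝ) • A x).det := by
      intro x hx
      rw [smul_eq_mul, mul_one, abs_of_pos]
      refine det_one_add_smul_pos t.2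
        (lt_of_le_of_lt ?_ (show (t : ℝ) * K < 1 by exact_mod_cast ht))
      exact mul_le_mul_of_nonneg_left (norm_fderiv_le_of_lipschitz ℝ hK) t.2
    have hmeas : MeasurableSet (Metric.ball (0 : V) 1) := measurableSet_ball
    constructor
    · rw [← integrableOn_congr_fun hpos hmeas,
        ← integrableOn_image_iff_integrableOn_abs_det_fderiv_smul volume hmeas hder hinj.injOn
          (fun _ => (1 : ℝ)), himg]
      exact integrableOn_const measure_ball_lt_top.ne
    · rw [← setIntegral_congr_fun hmeas hpos,
        ← integral_image_eq_integral_abs_det_fderiv_smul volume hmeas hder hinj.injOn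
          (fun _ => (1 : ℝ)), himg]
      simp
  -- Distinct nodes in the range where `id + t g` is a bijection.
  let v : ℕ → NNReal := fun i => (K + 1 + i)⁻¹
  have hv1 : ∀ i, v i * K < 1 := by
    intro i
    have hp : (0 : NNReal) < K + 1 + i := by positivity
    rw [inv_mul_lt_iff₀ hp, mul_one, add_assoc]
    exact lt_add_of_pos_right K (by positivity)
  have hvinj : Function.Injective fun i => (v i : ℝ) := by
    intro i j hij
    have h1 : v i = v j := NNReal.coe_injective hij
    have h2 : (K + 1 + i : NNReal) = K + 1 + j := inv_injective h1
    exact_mod_cast add_left_cancel h2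
  set s := Finset.range (Module.finrank ℝ V + 1) with hsdef
  have hsum : ∑ i ∈ s, (Lagrange.basis s (fun i => (v i : ℝ)) i).eval 1 = 1 := by
    rw [← Polynomial.eval_finsetSum, Lagrange.sum_basis hvinj.injOn (by simp [hsdef]),
      Polynomial.eval_one]
  have hint : ∫ x in Metric.ball (0 : V) 1, ((1 : V →L[ℝ] V) + A x).det =
      volume.real (Metric.ball (0 : V) 1) := by
    rw [setIntegral_congr_fun measurableSet_ball fun x _ => det_one_add_eq_sum hvinj (A x)]
    rw [integral_finsetSum _ fun i _ => ((hsmall (v i) (hv1 i)).1.const_mul _)]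
    simp_rw [integral_const_mul, (hsmall (v _) (hv1 _)).2]
    rw [← Finset.sum_mul, ← hsdef, hsum, one_mul]
  rw [setIntegral_congr_fun measurableSet_ball hdet] at hint
  have hvol : 0 < volume.real (Metric.ball (0 : V) 1) := by
    rw [measureReal_def]
    exact ENNReal.toReal_pos (Metric.measure_ball_pos volume 0 one_pos).ne' measure_ball_lt_top.ne
  simp only [integral_zero] at hint
  exact hvol.ne hint

end NoRetraction

/-! ### Continuous functions on subsets -/

section Continuity

/-- The Tietze extension theorem for functions that are continuous on a closed set. -/
lemma ContinuousOn.exists_continuousMap_eqOn.{u, v} {X : Type u} {W : Type v} [TopologicalSpace X]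
    [NormalSpace X] [TopologicalSpace W] [TietzeExtension.{u, v} W] {s : Set X}
    (hs : IsClosed s) {f : X → W} (hf : ContinuousOn f s) : ∃ g : C(X, W), EqOn g f s := by
  obtain ⟨g, hg⟩ := ContinuousMap.exists_restrict_eq hs ⟨_, hf.domRestrict⟩
  exact ⟨g, fun x hx => congrFun (congrArg DFunLike.coe hg) ⟨x, hx⟩⟩

/-- A continuous function without zeros is bounded away from zero on a compact set. -/
lemma IsCompact.exists_forall_le_norm {X W : Type*} [TopologicalSpace X] [NormedAddCommGroup W]
    {s : Set X} (hs : IsCompact s) {f : X → W} (hf : ContinuousOn f s) (h0 : ∀ x ∈ s, f x ≠ 0) :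
    ∃ η > 0, ∀ x ∈ s, η ≤ ‖f x‖ := by
  rcases s.eq_empty_or_nonempty with rfl | hne
  · exact ⟨1, one_pos, by simp⟩
  · obtain ⟨x, hx, hm⟩ := hs.exists_isMinOn hne hf.norm
    exact ⟨‖f x‖, norm_pos_iff.2 (h0 x hx), fun y hy => hm hy⟩

/-- A continuous function on a subspace, as a function on the ambient space. -/
lemma Continuous.exists_continuousOn {X Y : Type*} [TopologicalSpace X] [TopologicalSpace Y]
    [Nonempty Y] {s : Set X} {F : s → Y} (hF : Continuous F) :
    ∃ G : X → Y, ContinuousOn G s ∧ ∀ x : s, G x = F x := by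
  obtain ⟨y⟩ := ‹Nonempty Y›
  have h : ∀ x : s, Function.extend Subtype.val F (fun _ => y) x = F x := fun x =>
    Subtype.val_injective.extend_apply F _ x
  refine ⟨Function.extend Subtype.val F fun _ => y, ?_, h⟩
  rw [continuousOn_iff_continuous_domRestrict]
  exact hF.congr fun x => (h x).symm

/-- A homeomorphism between subspaces, as a pair of mutually inverse functions on the ambient
spaces. -/
lemma Homeomorph.exists_continuousOn_invOn {X Y : Type*} [TopologicalSpace X] [TopologicalSpace Y]
    [Nonempty X] [Nonempty Y] {s : Set X} {t : Set Y} (e : s ≃ₜ t) :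
    ∃ (φ : X → Y) (ψ : Y → X), ContinuousOn φ s ∧ ContinuousOn ψ t ∧ MapsTo φ s t ∧
      MapsTo ψ t s ∧ (∀ x ∈ s, ψ (φ x) = x) ∧ ∀ y ∈ t, φ (ψ y) = y := by
  obtain ⟨φ, hφ, hφe⟩ := (continuous_subtype_val.comp e.continuous).exists_continuousOn
  obtain ⟨ψ, hψ, hψe⟩ := (continuous_subtype_val.comp e.symm.continuous).exists_continuousOn
  refine ⟨φ, ψ, hφ, hψ, fun x hx => ?_, fun y hy => ?_, fun x hx => ?_, fun y hy => ?_⟩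
  · rw [hφe ⟨x, hx⟩]
    exact (e _).2
  · rw [hψe ⟨y, hy⟩]
    exact (e.symm _).2
  · rw [hφe ⟨x, hx⟩, Function.comp_apply, hψe]
    simp
  · rw [hψe ⟨y, hy⟩, Function.comp_apply, hφe]
    simp

end Continuity

/-! ### Brouwer's theorem and invariance of domain -/

section InvarianceOfDomain

variable {V : Type*} [NormedAddCommGroup V] [InnerProductSpace ℝ V] [FiniteDimensional ℝ V]

/-- A form of Brouwer's fixed point theorem: a continuous map on the closed unit ball that moves
the points of the unit sphere by less than `1` has a zero. Otherwise a smooth approximation could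
be deformed to the identity on the sphere and normalized to a retraction. -/
theorem exists_eq_zero_of_norm_sub_lt_one {H : V → V} (hH : ContinuousOn H (Metric.closedBall 0 1))
    (hs : ∀ x, ‖x‖ = 1 → ‖H x - x‖ < 1) : ∃ x ∈ Metric.closedBall (0 : V) 1, H x = 0 := by
  by_contra! hne
  have hball : IsCompact (Metric.closedBall (0 : V) 1) := isCompact_closedBall 0 1
  obtain ⟨H', hH'⟩ := hH.exists_continuousMap_eqOn hball.isClosed
  obtain ⟨c, hc, hcH⟩ := hball.exists_forall_le_norm hH hne
  obtain ⟨m, hm, hmH⟩ : ∃ m : ℝ, 0 < m ∧ ∀ x, ‖x‖ = 1 → ‖H x - x‖ + m ≤ 1 := by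
    have hcont : ContinuousOn (fun x => 1 - ‖H x - x‖) (Metric.sphere (0 : V) 1) :=
      continuousOn_const.sub ((hH.mono Metric.sphere_subset_closedBall).sub continuousOn_id).norm
    obtain ⟨m, hm, h⟩ := (isCompact_sphere (0 : V) 1).exists_forall_le_norm hcont fun x hx =>
      (sub_pos.2 (hs x (by simpa using hx))).ne'
    refine ⟨m, hm, fun x hx => ?_⟩
    have h1 := h x (by simpa using hx)
    rw [Real.norm_of_nonneg (sub_pos.2 (hs x hx)).le] at h1
    linarith
  obtain ⟨Q, hQ, hQH, -⟩ := H'.continuous.exists_contDiff_approx 1 (ε := fun _ => min c m)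
    continuous_const fun _ => lt_min hc hm
  have hQn : ∀ x ∈ Metric.closedBall (0 : V) 1, ‖Q x - H x‖ < min c m := by
    intro x hx
    rw [← hH' hx, ← dist_eq_norm]
    exact hQH x
  have hQ0 : ∀ x ∈ Metric.closedBall (0 : V) 1, Q x ≠ 0 := by
    intro x hx h0
    have h1 := hQn x hx
    rw [h0, zero_sub, norm_neg] at h1
    exact absurd (hcH x hx) (not_le.2 (h1.trans_le (min_le_left _ _)))
  have hQs : ∀ x, ‖x‖ = 1 → ‖Q x - x‖ < 1 := by
    intro x hx
    have h1 := hQn x (by simpa using hx.le)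
    have h2 := norm_sub_le_norm_sub_add_norm_sub (Q x) (H x) x
    have h3 := hmH x hx
    have h4 := min_le_right c m
    linarith
  -- A cut-off that is `1` on the sphere and `0` where the segment from `Q x` to `x` may meet `0`.
  have hN : IsClosed (Metric.closedBall (0 : V) 1 ∩ {x | ‖x‖ ≤ ‖Q x - x‖}) :=
    Metric.isClosed_closedBall.inter
      (isClosed_le continuous_norm (hQ.continuous.sub continuous_id).norm)
  obtain ⟨χ, hχ0, hχ1, hχ⟩ := exists_contMDiffMap_zero_one_of_isClosed (n := 1)
    (modelWithCornersSelf ℝ V) hN (Metric.isClosed_sphere (x := (0 : V)) (ε := 1)) (by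
      rw [Set.disjoint_left]
      rintro x ⟨-, hx⟩ hx'
      have hx1 : ‖x‖ = 1 := by simpa using hx'
      exact absurd (hQs x hx1) (not_lt.2 (hx1 ▸ hx)))
  have hχd : ContDiff ℝ 1 χ := χ.contMDiff.contDiff
  let T : V → V := fun x => Q x + χ x • (x - Q x)
  have hT : ContDiff ℝ 1 T := hQ.add (hχd.smul (contDiff_id.sub hQ))
  have hTs : ∀ x, ‖x‖ = 1 → T x = x := by
    intro x hx
    have : χ x = 1 := hχ1 (by simpa using hx)
    simp [T, this]
  have hT0 : ∀ x ∈ Metric.closedBall (0 : V) 1, T x ≠ 0 := by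
    intro x hx h0
    by_cases hxN : ‖x‖ ≤ ‖Q x - x‖
    · have : χ x = 0 := hχ0 ⟨hx, hxN⟩
      exact hQ0 x hx (by simpa [T, this] using h0)
    · have h1 : x = -((1 - χ x) • (Q x - x)) := by
        have : T x = x + (1 - χ x) • (Q x - x) := by
          simp only [T]
          module
        rw [this] at h0
        exact eq_neg_of_add_eq_zero_left h0
      have h2 : ‖x‖ = (1 - χ x) * ‖Q x - x‖ := by
        conv_lhs => rw [h1]
        rw [norm_neg, norm_smul, Real.norm_of_nonneg (sub_nonneg.2 (hχ x).2)]
      have h3 : (1 - χ x) * ‖Q x - x‖ ≤ ‖Q x - x‖ :=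
        mul_le_of_le_one_left (norm_nonneg _) (by linarith [(hχ x).1])
      exact hxN (h2.trans_le h3)
  refine not_contDiffAt_retraction_sphere (f := fun x => ‖T x‖⁻¹ • T x) (fun x hx => ?_)
    (fun x hx => ?_) fun x hx => ?_
  · exact ((hT.contDiffAt.norm ℝ (hT0 x hx)).inv (norm_ne_zero_iff.2 (hT0 x hx))).smul hT.contDiffAt
  · rw [norm_smul, norm_inv, norm_norm, inv_mul_cancel₀ (norm_ne_zero_iff.2 (hT0 x hx))]
  · simp [hTs x hx, hx]

open MeasureTheory in
/-- Invariance of domain: the centre of the closed unit ball is mapped to an interior point of the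
image by every topological embedding `F`, here given with its inverse `G`. If it were not, then
pushing the image away from a nearby point off the image, and moving `G` slightly, would make `G`
free of zeros. -/
theorem mem_interior_image_closedBall {F G : V → V} (hF : ContinuousOn F (Metric.closedBall 0 1))
    (hG : ContinuousOn G (F '' Metric.closedBall 0 1))
    (hGF : ∀ x ∈ Metric.closedBall (0 : V) 1, G (F x) = x) :
    F 0 ∈ interior (F '' Metric.closedBall 0 1) := by
  by_contra hint
  have h0 : (0 : V) ∈ Metric.closedBall (0 : V) 1 := by simp
  set K := F '' Metric.closedBall 0 1 with hKdef
  have hK : IsCompact K := (isCompact_closedBall 0 1).image_of_continuousOn hF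
  obtain ⟨G', hG'⟩ := hG.exists_continuousMap_eqOn hK.isClosed
  have hGF' : ∀ x ∈ Metric.closedBall (0 : V) 1, G' (F x) = x := fun x hx => by
    rw [hG' (mem_image_of_mem F hx), hGF x hx]
  obtain ⟨δ, hδ, hδG⟩ : ∃ δ > 0, ∀ y, dist y (F 0) < 2 * δ → ‖G' y‖ < 1 / 10 := by
    obtain ⟨d, hd, h⟩ := Metric.continuousAt_iff.1 (G'.continuous.continuousAt (x := F 0))
      (1 / 10) (by norm_num)
    refine ⟨d / 2, by positivity, fun y hy => ?_⟩
    have := h (x := y) (by linarith)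
    rwa [hGF' 0 h0, dist_zero_right] at this
  obtain ⟨c, hcK, hc⟩ : ∃ c, c ∉ K ∧ dist c (F 0) < δ := by
    by_contra! hcon
    refine hint (mem_interior_iff_mem_nhds.2 (Metric.mem_nhds_iff.2 ⟨δ, hδ, fun c hc => ?_⟩))
    by_contra hcK
    exact absurd hc (not_lt.2 (hcon c hcK))
  have hK1 : IsCompact (K ∩ {y | δ ≤ dist y c}) :=
    hK.inter_right (isClosed_le continuous_const (continuous_id.dist continuous_const))
  obtain ⟨η, hη, hηG⟩ := hK1.exists_forall_le_norm G'.continuous.continuousOn (by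
    rintro _ ⟨⟨x, hx, rfl⟩, hxc⟩ h
    rw [hGF' x hx] at h
    rw [mem_ofPred_eq, h, dist_comm] at hxc
    exact absurd hc (not_lt.2 hxc))
  set ε := min (η / 2) (1 / 10) with hεdef
  have hε : 0 < ε := lt_min (by positivity) (by norm_num)
  obtain ⟨Q, hQ, hQG, -⟩ := G'.continuous.exists_contDiff_approx 1 (ε := fun _ => ε)
    continuous_const fun _ => hε
  -- The image of a sphere under `Q` is a null set, hence misses some small vector `v`.
  obtain ⟨v, hv, hvQ⟩ : ∃ v, ‖v‖ < ε ∧ v ∉ Q '' Metric.sphere c δ := by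
    let : MeasurableSpace V := borel V
    have : BorelSpace V := ⟨rfl⟩
    have hnull : (volume : Measure V) (Q '' Metric.sphere c δ) = 0 :=
      addHaar_image_eq_zero_of_differentiableOn_of_addHaar_eq_zero volume
        (hQ.differentiable (by simp)).differentiableOn
        (Measure.addHaar_sphere_of_ne_zero volume c hδ.ne')
    by_contra! hcon
    have hsub : Metric.ball (0 : V) ε ⊆ Q '' Metric.sphere c δ := fun v hv =>
      hcon v (by simpa using hv)
    exact (Metric.measure_ball_pos volume (0 : V) hε).ne' (measure_mono_null hsub hnull)
  have hPG : ∀ y, ‖Q y - v - G' y‖ < 2 * ε := by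
    intro y
    have h1 : ‖Q y - G' y - v‖ ≤ ‖Q y - G' y‖ + ‖v‖ := norm_sub_le _ _
    have h2 := hQG y
    rw [dist_eq_norm] at h2
    rw [sub_right_comm]
    linarith
  have hne : ∀ y ∈ K, y - c ≠ 0 := fun y hy h => hcK (sub_eq_zero.1 h ▸ hy)
  let Φ : V → V := fun y => c + max (δ / ‖y - c‖) 1 • (y - c)
  have hΦ : ContinuousOn Φ K := by
    have h1 : ContinuousOn (fun y : V => y - c) K := by fun_prop
    exact continuousOn_const.add (((continuousOn_const.div h1.norm fun y hy =>
      norm_ne_zero_iff.2 (hne y hy)).sup continuousOn_const).smul h1)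
  have hΦfar : ∀ y ∈ K, δ ≤ dist y c → Φ y = y := by
    intro y hy hyc
    have : δ / ‖y - c‖ ≤ 1 := by
      rw [div_le_one (norm_pos_iff.2 (hne y hy)), ← dist_eq_norm]
      exact hyc
    simp [Φ, max_eq_right this]
  have hΦnear : ∀ y ∈ K, dist y c < δ → dist (Φ y) c = δ := by
    intro y hy hyc
    have hpos := norm_pos_iff.2 (hne y hy)
    have : 1 ≤ δ / ‖y - c‖ := by
      rw [one_le_div hpos, ← dist_eq_norm]
      exact hyc.le
    simp only [Φ, max_eq_left this]
    rw [dist_eq_norm, add_sub_cancel_left, norm_smul, Real.norm_of_nonneg (by positivity),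
      div_mul_cancel₀ _ hpos.ne']
  have hε1 : ε ≤ η / 2 := min_le_left _ _
  have hε2 : ε ≤ 1 / 10 := min_le_right _ _
  obtain ⟨x, hx, hx0⟩ := exists_eq_zero_of_norm_sub_lt_one (H := fun x => Q (Φ (F x)) - v)
    ((hQ.continuous.comp_continuousOn (hΦ.comp hF (mapsTo_image _ _))).sub continuousOn_const) (by
      intro x hx
      have hx' : x ∈ Metric.closedBall (0 : V) 1 := by simpa using hx.le
      have hxK : F x ∈ K := mem_image_of_mem F hx'
      rcases le_or_gt δ (dist (F x) c) with hfar | hnear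
      · have := hPG (F x)
        rw [hGF' x hx'] at this
        rw [hΦfar _ hxK hfar]
        linarith
      · have h1 : ‖x‖ < 1 / 10 := by
          have := hδG (F x) (by linarith [dist_triangle (F x) c (F 0)])
          rwa [hGF' x hx'] at this
        norm_num [hx] at h1)
  have hxK : F x ∈ K := mem_image_of_mem F hx
  rcases le_or_gt δ (dist (F x) c) with hfar | hnear
  · rw [hΦfar _ hxK hfar] at hx0
    have h1 := hPG (F x)
    rw [hx0, zero_sub, norm_neg] at h1
    have h2 := hηG (F x) ⟨hxK, hfar⟩
    linarith
  · exact hvQ ⟨Φ (F x), hΦnear _ hxK hnear, sub_eq_zero.1 hx0⟩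

end InvarianceOfDomain

/-! ### The boundary of an embedded ball -/

section BoundaryOfBall

variable {V : Type*} [NormedAddCommGroup V] [InnerProductSpace ℝ V] [FiniteDimensional ℝ V]

/-- A homeomorphism `φ` from the closed unit ball onto a subset `B` of the ambient space maps the
open ball onto the interior of `B`, and hence the sphere onto the boundary. -/
theorem mem_interior_iff_norm_lt_one {B : Set V} {φ ψ : V → V}
    (hφ : ContinuousOn φ (Metric.closedBall 0 1)) (hψ : ContinuousOn ψ B)
    (hφB : MapsTo φ (Metric.closedBall 0 1) B) (hψB : MapsTo ψ B (Metric.closedBall 0 1))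
    (hψφ : ∀ x ∈ Metric.closedBall (0 : V) 1, ψ (φ x) = x) (hφψ : ∀ y ∈ B, φ (ψ y) = y)
    {x : V} (hx : x ∈ Metric.closedBall (0 : V) 1) : φ x ∈ interior B ↔ ‖x‖ < 1 := by
  have hx1 : ‖x‖ ≤ 1 := by simpa using hx
  constructor
  · -- Otherwise a small sphere in `B` around `φ x` is contracted in `B \ {φ x}`, because the
    -- closed ball without its boundary point `x` is star-shaped about `0`.
    intro hxi
    by_contra hx'
    have hx1 : ‖x‖ = 1 := le_antisymm hx1 (not_lt.1 hx')
    obtain ⟨ε, hε, hεB⟩ := Metric.nhds_basis_closedBall.mem_iff.1 (mem_interior_iff_mem_nhds.1 hxi)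
    have hmem : ∀ y ∈ Metric.closedBall (0 : V) 1, φ x + ε • y ∈ B := by
      intro y hy
      apply hεB
      have hy1 : ‖y‖ ≤ 1 := by simpa using hy
      rw [Metric.mem_closedBall, dist_eq_norm, add_sub_cancel_left, norm_smul,
        Real.norm_of_nonneg hε.le]
      exact mul_le_of_le_one_right hε.le hy1
    have hmem2 : ∀ y ∈ Metric.closedBall (0 : V) 1,
        ‖y‖ • ψ (φ x + ε • y) ∈ Metric.closedBall (0 : V) 1 := by
      intro y hy
      have hy1 : ‖y‖ ≤ 1 := by simpa using hy
      have h2 : ‖ψ (φ x + ε • y)‖ ≤ 1 := by simpa using hψB (hmem y hy)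
      rw [mem_closedBall_zero_iff, norm_smul, norm_norm]
      exact mul_le_one₀ hy1 (norm_nonneg _) h2
    obtain ⟨y, hy, hy0⟩ := exists_eq_zero_of_norm_sub_lt_one
      (H := fun y => ε⁻¹ • (φ (‖y‖ • ψ (φ x + ε • y)) - φ x))
      (by
        have h1 : ContinuousOn (fun y : V => φ x + ε • y) (Metric.closedBall 0 1) := by fun_prop
        have h2 : ContinuousOn (fun y : V => ‖y‖ • ψ (φ x + ε • y)) (Metric.closedBall 0 1) :=
          continuous_norm.continuousOn.smul (hψ.comp h1 hmem)
        exact ((hφ.comp h2 hmem2).sub continuousOn_const).const_smul ε⁻¹)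
      (by
        intro y hy
        rw [hy, one_smul, hφψ _ (hmem y (by simpa using hy.le)), add_sub_cancel_left,
          inv_smul_smul₀ hε.ne', sub_self, norm_zero]
        exact one_pos)
    have hy1 : ‖y‖ ≤ 1 := by simpa using hy
    have h1 : φ (‖y‖ • ψ (φ x + ε • y)) = φ x :=
      sub_eq_zero.1 ((smul_eq_zero.1 hy0).resolve_left (inv_ne_zero hε.ne'))
    have h2 : ‖y‖ • ψ (φ x + ε • y) = x := by
      rw [← hψφ _ (hmem2 y hy), h1, hψφ x hx]
    have h3 : ‖ψ (φ x + ε • y)‖ ≤ 1 := by simpa using hψB (hmem y hy)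
    have h4 : ‖y‖ * ‖ψ (φ x + ε • y)‖ = 1 := by
      rw [← hx1, ← h2, norm_smul, norm_norm, h2]
    have h5 : ‖y‖ = 1 := by
      refine le_antisymm hy1 ?_
      rw [← h4]
      exact mul_le_of_le_one_right (norm_nonneg y) h3
    rw [h5, one_smul] at h2
    have h6 : φ x + ε • y = φ x := by rw [← hφψ _ (hmem y hy), h2]
    have h7 : y = 0 := (smul_eq_zero.1 (add_eq_left.1 h6)).resolve_left hε.ne'
    rw [h7, norm_zero] at h5
    exact zero_ne_one h5
  · intro hx'
    have hr : 0 < 1 - ‖x‖ := sub_pos.2 hx'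
    have hmaps : MapsTo (fun y => x + (1 - ‖x‖) • y) (Metric.closedBall (0 : V) 1)
        (Metric.closedBall 0 1) := by
      intro y hy
      have hy1 : ‖y‖ ≤ 1 := by simpa using hy
      rw [mem_closedBall_zero_iff]
      refine (norm_add_le _ _).trans ?_
      rw [norm_smul, Real.norm_of_nonneg hr.le]
      nlinarith
    have hsub : (fun y => φ (x + (1 - ‖x‖) • y)) '' Metric.closedBall 0 1 ⊆ B := by
      rintro _ ⟨y, hy, rfl⟩
      exact hφB (hmaps hy)
    have h := mem_interior_image_closedBall (F := fun y => φ (x + (1 - ‖x‖) • y))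
      (G := fun z => (1 - ‖x‖)⁻¹ • (ψ z - x)) (hφ.comp (by fun_prop) hmaps)
      (((hψ.mono hsub).sub continuousOn_const).const_smul _) (by
        intro y hy
        rw [hψφ _ (hmaps hy), add_sub_cancel_left, inv_smul_smul₀ hr.ne'])
    rw [smul_zero, add_zero] at h
    exact interior_mono hsub h

end BoundaryOfBall

/-! ### Extension of maps into spheres of larger dimension -/

section SphereExtension

variable {V W : Type*} [NormedAddCommGroup V] [NormedSpace ℝ V] [FiniteDimensional ℝ V]
  [NormedAddCommGroup W] [InnerProductSpace ℝ W] [FiniteDimensional ℝ W]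

/-- A continuous map from a closed subset of `V` into the unit sphere of a space of larger dimension
extends to all of `V`: a smooth approximation misses a point close to the origin, so that it can be
moved off the origin, corrected near the closed set, and normalized. -/
theorem ContinuousOn.exists_extension_norm_eq_one
    (hdim : Module.finrank ℝ V < Module.finrank ℝ W) {A : Set V} (hA : IsClosed A) {L : V → W}
    (hL : ContinuousOn L A) (hL1 : ∀ x ∈ A, ‖L x‖ = 1) :
    ∃ G : V → W, Continuous G ∧ EqOn G L A ∧ ∀ x, ‖G x‖ = 1 := by
  obtain ⟨L', hL'⟩ := hL.exists_continuousMap_eqOn hA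
  obtain ⟨Q, hQ, hQL, -⟩ := L'.continuous.exists_contDiff_approx 1 (ε := fun _ => 1 / 2)
    continuous_const fun _ => by norm_num
  obtain ⟨v, hvQ, hv⟩ := (hQ.dense_compl_range_of_finrank_lt_finrank hdim).exists_mem_open
    Metric.isOpen_ball ⟨(0 : W), Metric.mem_ball_self (show (0 : ℝ) < 1 / 4 by norm_num)⟩
  have hv' : ‖v‖ < 1 / 4 := by simpa using hv
  have hP : ∀ x, ‖L' x - (Q x - v)‖ < 3 / 4 := by
    intro x
    have h1 := hQL x
    rw [dist_comm, dist_eq_norm] at h1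
    rw [sub_sub_eq_add_sub, add_sub_right_comm]
    linarith [norm_add_le (L' x - Q x) v]
  have hP0 : ∀ x, Q x - v ≠ 0 := fun x h => hvQ ⟨x, sub_eq_zero.1 h⟩
  let χ : V → ℝ := fun x => max 0 (min 1 (4 * ‖L' x‖ - 3))
  have hχ : Continuous χ := by fun_prop
  have hχ0 : ∀ x, 0 ≤ χ x := fun x => le_max_left _ _
  have hχ1 : ∀ x, χ x ≤ 1 := fun x => max_le zero_le_one (min_le_left _ _)
  let T : V → W := fun x => (Q x - v) + χ x • (L' x - (Q x - v))
  have hT : Continuous T := by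
    have := hQ.continuous
    fun_prop
  have hT0 : ∀ x, T x ≠ 0 := by
    intro x h0
    rcases le_or_gt ‖L' x‖ (3 / 4) with h | h
    · have : χ x = 0 := max_eq_left ((min_le_right _ _).trans (by linarith))
      exact hP0 x (by simpa [T, this] using h0)
    · have h1 : L' x = (1 - χ x) • (L' x - (Q x - v)) := by
        have : T x = L' x - (1 - χ x) • (L' x - (Q x - v)) := by
          simp only [T]
          module
        rw [this] at h0
        exact sub_eq_zero.1 h0
      have h2 : ‖L' x‖ ≤ ‖L' x - (Q x - v)‖ := by
        conv_lhs => rw [h1]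
        rw [norm_smul, Real.norm_of_nonneg (sub_nonneg.2 (hχ1 x))]
        exact mul_le_of_le_one_left (norm_nonneg _) (by linarith [hχ0 x])
      linarith [hP x]
  refine ⟨fun x => ‖T x‖⁻¹ • T x, (hT.norm.inv₀ fun x => norm_ne_zero_iff.2 (hT0 x)).smul hT,
    fun x hx => ?_, fun x => ?_⟩
  · have h1 : ‖L' x‖ = 1 := by rw [hL' hx, hL1 x hx]
    have h2 : χ x = 1 := by
      simp only [χ, h1]
      norm_num
    have h3 : T x = L x := by
      simp [T, h2, hL' hx]
    simp [h3, hL1 x hx]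
  · rw [norm_smul, norm_inv, norm_norm, inv_mul_cancel₀ (norm_ne_zero_iff.2 (hT0 x))]

end SphereExtension

/-! ### Lifting maps from the sphere through coverings -/

section LiftSphere

variable {V : Type*} [NormedAddCommGroup V] [InnerProductSpace ℝ V]
  {E X : Type*} [TopologicalSpace E] [TopologicalSpace X] {p : E → X}

/-- A map from the sphere lifts through a covering off any given point, by stereographic
projection. -/
lemma IsCoveringMap.exists_lift_compl_singleton [FiniteDimensional ℝ V] (cov : IsCoveringMap p)
    (f : C(Metric.sphere (0 : V) 1, X)) (v a : Metric.sphere (0 : V) 1) (hav : a ≠ v) (e : E)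
    (he : p e = f a) : ∃ L : Metric.sphere (0 : V) 1 → E,
      ContinuousOn L {v}ᶜ ∧ (∀ x ≠ v, p (L x) = f x) ∧ L a = e := by
  have hv : ‖(v : V)‖ = 1 := norm_eq_of_mem_sphere v
  let σ := stereographic hv
  have hsrc : ∀ x, x ≠ v → x ∈ σ.source := by
    intro x hx
    simpa [σ, stereographic_source] using hx
  have hcont : Continuous σ.symm := by
    have := σ.continuousOn_symm
    rwa [show σ.target = univ from stereographic_target hv, continuousOn_univ] at this
  obtain ⟨F, ⟨hF0, hF⟩, -⟩ := cov.existsUnique_continuousMap_lifts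
    (f.comp ⟨σ.symm, hcont⟩) (σ a) e (by
      rw [he]
      exact (congrArg f (σ.left_inv (hsrc a hav))).symm)
  refine ⟨fun x => F (σ x), F.continuous.comp_continuousOn ?_, fun x hx => ?_, hF0⟩
  · exact σ.continuousOn.mono fun x hx => hsrc x hx
  · have h := congrFun hF (σ x)
    refine h.trans (congrArg f (σ.left_inv (hsrc x hx)))

lemma isPreconnected_compl_pair_sphere (hdim : 2 < Module.finrank ℝ V)
    (v : Metric.sphere (0 : V) 1) : IsPreconnected ({v, -v}ᶜ : Set (Metric.sphere (0 : V) 1)) := by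
  have : FiniteDimensional ℝ V := .of_finrank_pos (by omega)
  have hv : ‖(v : V)‖ = 1 := norm_eq_of_mem_sphere v
  have hv0 : (v : V) ≠ 0 := fun h => by simp [h] at hv
  let σ := stereographic hv
  have hcont : Continuous σ.symm := by
    have := σ.continuousOn_symm
    rwa [show σ.target = univ from stereographic_target hv, continuousOn_univ] at this
  have hrank : 1 < Module.rank ℝ (ℝ ∙ (v : V))ᗮ := by
    have h1 := Submodule.finrank_add_finrank_orthogonal (ℝ ∙ (v : V))
    rw [finrank_span_singleton hv0] at h1
    rw [← Module.finrank_eq_rank]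
    exact_mod_cast (by omega : 1 < Module.finrank ℝ (ℝ ∙ (v : V))ᗮ)
  have hc := (isConnected_compl_singleton_of_one_lt_rank hrank 0).isPreconnected.image σ.symm
    hcont.continuousOn
  have himg : σ.symm '' {0}ᶜ = {v, -v}ᶜ := by
    have h0 : σ (-v) = 0 := stereographic_apply_neg v
    ext x
    constructor
    · rintro ⟨w, hw, rfl⟩
      have hwt : w ∈ σ.target := by simp [σ, stereographic_target]
      have hws := σ.map_target hwt
      simp only [mem_compl_iff, mem_insert_iff, mem_singleton_iff, not_or]
      refine ⟨fun h => ?_, fun h => hw ?_⟩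
      · simp [σ, stereographic_source, h] at hws
      · rw [mem_singleton_iff, ← h0, ← h, σ.right_inv hwt]
    · intro hx
      simp only [mem_compl_iff, mem_insert_iff, mem_singleton_iff, not_or] at hx
      have hxs : x ∈ σ.source := by simpa [σ, stereographic_source] using hx.1
      have hnv : -v ∈ σ.source := by
        have : -v ≠ v := (ne_neg_of_mem_unit_sphere ℝ v).symm
        simpa [σ, stereographic_source] using this
      refine ⟨σ x, fun h => hx.2 (σ.injOn hxs hnv ?_), σ.left_inv hxs⟩
      rw [h0]
      exact h
  rwa [himg] at hc

/-- Maps from a sphere of dimension at least two lift through coverings: lifts off two antipodal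
points agree where both are defined, as the sphere minus these points is connected. -/
theorem IsCoveringMap.exists_lift_sphere (cov : IsCoveringMap p) (hp : Function.Surjective p)
    (hdim : 2 < Module.finrank ℝ V) (f : C(Metric.sphere (0 : V) 1, X)) :
    ∃ F : C(Metric.sphere (0 : V) 1, E), ∀ x, p (F x) = f x := by
  classical
  have : FiniteDimensional ℝ V := .of_finrank_pos (by omega)
  have : Nontrivial V := Module.nontrivial_of_finrank_pos (R := ℝ) (by omega)
  obtain ⟨v⟩ : Nonempty (Metric.sphere (0 : V) 1) :=
    (NormedSpace.sphere_nonempty.2 zero_le_one).to_subtype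
  have hv : ‖(v : V)‖ = 1 := norm_eq_of_mem_sphere v
  have hv0 : (v : V) ≠ 0 := fun h => by simp [h] at hv
  have hvn : v ≠ -v := ne_neg_of_mem_unit_sphere ℝ v
  obtain ⟨a, hav, hav'⟩ : ∃ a, a ≠ v ∧ a ≠ -v := by
    obtain ⟨w, hw⟩ : ∃ w : (ℝ ∙ (v : V))ᗮ, w ≠ 0 := by
      have h1 := Submodule.finrank_add_finrank_orthogonal (ℝ ∙ (v : V))
      rw [finrank_span_singleton hv0] at h1
      have : Nontrivial (ℝ ∙ (v : V))ᗮ := Module.nontrivial_of_finrank_pos (R := ℝ) (by omega)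
      exact exists_ne 0
    have hwv : inner ℝ (v : V) w = 0 := Submodule.mem_orthogonal_singleton_iff_inner_right.1 w.2
    have hw0 : ‖(w : V)‖ ≠ 0 := by simpa using hw
    let a : Metric.sphere (0 : V) 1 := ⟨‖(w : V)‖⁻¹ • (w : V), by
      rw [mem_sphere_zero_iff_norm, norm_smul, norm_inv, norm_norm, inv_mul_cancel₀ hw0]⟩
    have hva : inner ℝ (v : V) a = 0 := by
      simp [a, inner_smul_right, hwv]
    have hvv : inner ℝ (v : V) v = 1 := by
      rw [real_inner_self_eq_norm_sq, hv, one_pow]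
    refine ⟨a, fun h => ?_, fun h => ?_⟩
    · rw [h, hvv] at hva
      exact one_ne_zero hva
    · rw [h, coe_neg_sphere, inner_neg_right, hvv] at hva
      norm_num at hva
  obtain ⟨e, he⟩ := hp (f a)
  obtain ⟨L₁, hL₁, hpL₁, hL₁a⟩ := cov.exists_lift_compl_singleton f v a hav e he
  obtain ⟨L₂, hL₂, hpL₂, hL₂a⟩ := cov.exists_lift_compl_singleton f (-v) a hav' e he
  have hagree : EqOn L₁ L₂ {v, -v}ᶜ := by
    refine cov.eqOn_of_comp_eqOn (isPreconnected_compl_pair_sphere hdim v)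
      (hL₁.mono (by simp)) (hL₂.mono (by simp)) (fun x hx => ?_) (a := a) (by simp [hav, hav'])
      (hL₁a.trans hL₂a.symm)
    simp only [mem_compl_iff, mem_insert_iff, mem_singleton_iff, not_or] at hx
    simp [hpL₁ x hx.1, hpL₂ x hx.2]
  let F : Metric.sphere (0 : V) 1 → E := fun x => if x = v then L₂ x else L₁ x
  have hF₂ : ∀ x, x ≠ -v → F x = L₂ x := by
    intro x hx
    by_cases hxv : x = v
    · simp [F, hxv]
    · simpa [F, hxv] using hagree (by simp [hxv, hx])
  refine ⟨⟨F, continuous_iff_continuousAt.2 fun x => ?_⟩, fun x => ?_⟩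
  · by_cases hxv : x = v
    · have hx : x ≠ -v := hxv ▸ hvn
      refine ((hL₂ x hx).continuousAt (isOpen_compl_singleton.mem_nhds hx)).congr ?_
      filter_upwards [isOpen_compl_singleton.mem_nhds hx] with y hy using (hF₂ y hy).symm
    · refine ((hL₁ x hxv).continuousAt (isOpen_compl_singleton.mem_nhds hxv)).congr ?_
      filter_upwards [isOpen_compl_singleton.mem_nhds hxv] with y hy
      have hy' : y ≠ v := hy
      simp [F, hy']
  · by_cases hxv : x = v
    · have hx : x ≠ -v := hxv ▸ hvn
      exact (congrArg p (hF₂ x hx)).trans (hpL₂ x hx)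
    · simp [F, hxv, hpL₁ x hxv]

end LiftSphere

/-! ### Unit quaternions and undirected frames -/

namespace FrameField

open scoped Quaternion

/-- The matrix of `x ↦ q x q̄` on the imaginary quaternions. -/
def rotMatrix (q : ℍ) : Matrix (Fin 3) (Fin 3) ℝ :=
  !![q.re ^ 2 + q.imI ^ 2 - q.imJ ^ 2 - q.imK ^ 2, 2 * (q.imI * q.imJ - q.re * q.imK),
      2 * (q.imI * q.imK + q.re * q.imJ);
    2 * (q.imI * q.imJ + q.re * q.imK), q.re ^ 2 - q.imI ^ 2 + q.imJ ^ 2 - q.imK ^ 2,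
      2 * (q.imJ * q.imK - q.re * q.imI);
    2 * (q.imI * q.imK - q.re * q.imJ), 2 * (q.imJ * q.imK + q.re * q.imI),
      q.re ^ 2 - q.imI ^ 2 - q.imJ ^ 2 + q.imK ^ 2]

lemma rotMatrix_mul (p q : ℍ) : rotMatrix (p * q) = rotMatrix p * rotMatrix q := by
  ext i j
  fin_cases i <;> fin_cases j <;>
    simp [rotMatrix, Matrix.mul_apply, Fin.sum_univ_three] <;> ring

lemma rotMatrix_one : rotMatrix 1 = 1 := by
  ext i j
  fin_cases i <;> fin_cases j <;> simp [rotMatrix]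

lemma rotMatrix_mul_transpose (q : ℍ) :
    rotMatrix q * (rotMatrix q).transpose =
      (q.re ^ 2 + q.imI ^ 2 + q.imJ ^ 2 + q.imK ^ 2) ^ 2 • (1 : Matrix (Fin 3) (Fin 3) ℝ) := by
  ext i j
  fin_cases i <;> fin_cases j <;>
    simp [rotMatrix, Matrix.mul_apply, Fin.sum_univ_three] <;> ring

lemma sum_sq_eq_one (q : Metric.sphere (0 : ℍ) 1) :
    (q : ℍ).re ^ 2 + (q : ℍ).imI ^ 2 + (q : ℍ).imJ ^ 2 + (q : ℍ).imK ^ 2 = 1 := by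
  rw [← Quaternion.normSq_def', Quaternion.normSq_eq_norm_mul_self, norm_eq_of_mem_sphere, one_mul]

/-- The double covering of the rotation group by the unit quaternions. -/
def rot : Metric.sphere (0 : ℍ) 1 →* O 3 where
  toFun q := ⟨rotMatrix q, by
    rw [Matrix.mem_orthogonalGroup_iff, rotMatrix_mul_transpose, sum_sq_eq_one,
      one_pow, one_smul]⟩
  map_one' := Subtype.ext rotMatrix_one
  map_mul' p q := Subtype.ext (rotMatrix_mul p q)

lemma continuous_rot : Continuous rot := by
  refine Continuous.subtype_mk ?_ _
  have h1 := Quaternion.continuous_re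
  have h2 := Quaternion.continuous_imI
  have h3 := Quaternion.continuous_imJ
  have h4 := Quaternion.continuous_imK
  refine continuous_matrix fun i j => ?_
  fin_cases i <;> fin_cases j <;> simp [rotMatrix] <;> fun_prop

/-- The quaternion with the given components, as an element of the unit sphere. -/
noncomputable def unitQuaternion (a b c d : ℝ) (h : a ^ 2 + b ^ 2 + c ^ 2 + d ^ 2 = 1) :
    Metric.sphere (0 : ℍ) 1 :=
  let q : ℍ := ⟨a, b, c, d⟩
  ⟨q, by
    have h1 : ‖q‖ * ‖q‖ = 1 := by
      rw [← Quaternion.normSq_eq_norm_mul_self, Quaternion.normSq_def']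
      exact h
    rw [mem_sphere_zero_iff_norm]
    nlinarith [norm_nonneg q]⟩

lemma finite_ker_rot : (rot.ker : Set (Metric.sphere (0 : ℍ) 1)).Finite := by
  refine ((Set.finite_singleton (-1 : Metric.sphere (0 : ℍ) 1)).insert 1).subset fun q hq => ?_
  have h : rotMatrix q = 1 := congrArg Subtype.val (show rot q = 1 from hq)
  have h0 := congrFun (congrFun h 0) 0
  have h1 := congrFun (congrFun h 1) 1
  have hs := sum_sq_eq_one q
  simp [rotMatrix] at h0 h1
  have hJ : (q : ℍ).imJ = 0 := by nlinarith
  have hK : (q : ℍ).imK = 0 := by nlinarith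
  have hI : (q : ℍ).imI = 0 := by nlinarith
  have hre : (q : ℍ).re * (q : ℍ).re = 1 := by simpa [hJ, hK, hI, sq] using hs
  rcases mul_self_eq_one_iff.1 hre with h | h
  · left
    ext <;> simp [h, hI, hJ, hK]
  · right
    ext <;> simp [h, hI, hJ, hK]

lemma det_rotMatrix (q : ℍ) :
    (rotMatrix q).det = (q.re ^ 2 + q.imI ^ 2 + q.imJ ^ 2 + q.imK ^ 2) ^ 3 := by
  rw [Matrix.det_fin_three]
  simp [rotMatrix]
  ring

lemma exists_rot_first_column {u v w : ℝ} (h : u ^ 2 + v ^ 2 + w ^ 2 = 1) :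
    ∃ q, (rot q).1 0 0 = u ∧ (rot q).1 1 0 = v ∧ (rot q).1 2 0 = w := by
  rcases eq_or_ne u (-1) with rfl | hu
  · have hv : v = 0 := by nlinarith
    have hw : w = 0 := by nlinarith
    refine ⟨unitQuaternion 0 0 1 0 (by norm_num), ?_⟩
    simp [rot, rotMatrix, unitQuaternion, hv, hw]
  · have hs : 0 < 2 + 2 * u := by
      have : -1 ≤ u := by nlinarith [sq_nonneg v, sq_nonneg w]
      have := lt_of_le_of_ne this hu.symm
      linarith
    have hn := Real.sq_sqrt hs.le
    have hn0 := (Real.sqrt_pos.2 hs).ne'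
    set n := √(2 + 2 * u)
    -- This is `1 - x i`, normalized, for the imaginary quaternion `x = u i + v j + w k`.
    refine ⟨unitQuaternion ((1 + u) / n) 0 (-w / n) (v / n) ?_, ?_, ?_, ?_⟩
    · field_simp
      rw [hn]
      linear_combination h
    · simp only [rot, rotMatrix, unitQuaternion, MonoidHom.coe_mk, OneHom.coe_mk, Matrix.of_apply,
        Matrix.cons_val_zero]
      field_simp
      rw [hn]
      linear_combination -h
    · simp [rot, rotMatrix, unitQuaternion]
      field_simp
      rw [hn]
      ring
    · simp [rot, rotMatrix, unitQuaternion]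
      field_simp
      rw [hn]
      ring

/-- Every point of the unit circle has a square root on the circle. -/
lemma exists_half_angle {c s : ℝ} (h : c ^ 2 + s ^ 2 = 1) :
    ∃ a b : ℝ, a ^ 2 + b ^ 2 = 1 ∧ a ^ 2 - b ^ 2 = c ∧ 2 * (a * b) = s := by
  let z : ℂ := ⟨c, s⟩
  obtain ⟨w, hw⟩ : ∃ w : ℂ, z = w * w := ⟨_, (Complex.cpow_nat_inv_pow z two_ne_zero).symm.trans
    (sq _)⟩
  have h1 : c = w.re * w.re - w.im * w.im := by
    rw [← Complex.mul_re, ← hw]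
  have h2 : s = w.re * w.im + w.im * w.re := by
    rw [← Complex.mul_im, ← hw]
  refine ⟨w.re, w.im, ?_, by rw [h1]; ring, by rw [h2]; ring⟩
  have : (w.re ^ 2 + w.im ^ 2) ^ 2 = 1 := by
    rw [← h, h1, h2]
    ring
  nlinarith [sq_nonneg w.re, sq_nonneg w.im]

lemma sum_col_mul_col (B : O 3) (i j : Fin 3) : B.1 0 i * B.1 0 j + B.1 1 i * B.1 1 j +
    B.1 2 i * B.1 2 j = (1 : Matrix (Fin 3) (Fin 3) ℝ) i j := by
  rw [← (Matrix.mem_orthogonalGroup_iff' _ _).1 B.2]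
  simp [Matrix.mul_apply, Fin.sum_univ_three]

lemma sum_row_mul_row (B : O 3) (i j : Fin 3) : B.1 i 0 * B.1 j 0 + B.1 i 1 * B.1 j 1 +
    B.1 i 2 * B.1 j 2 = (1 : Matrix (Fin 3) (Fin 3) ℝ) i j := by
  rw [← (Matrix.mem_orthogonalGroup_iff _ _).1 B.2]
  simp [Matrix.mul_apply, Fin.sum_univ_three]

lemma rot_unitQuaternion_axis (a b : ℝ) (h : a ^ 2 + b ^ 2 + 0 ^ 2 + 0 ^ 2 = 1) :
    (rot (unitQuaternion a b 0 0 h)).1 =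
      !![1, 0, 0; 0, a ^ 2 - b ^ 2, -(2 * (a * b)); 0, 2 * (a * b), a ^ 2 - b ^ 2] := by
  have h' : a ^ 2 + b ^ 2 = 1 := by linarith
  simp [rot, rotMatrix, unitQuaternion, h']

/-- A rotation about the first axis comes from a unit quaternion. -/
lemma exists_rot_eq_of_first_column {B : O 3} (hdet : B.1.det = 1) (b00 : B.1 0 0 = 1)
    (b10 : B.1 1 0 = 0) (b20 : B.1 2 0 = 0) : ∃ q, rot q = B := by
  have r0 := sum_row_mul_row B 0 0
  have c1 := sum_col_mul_col B 1 1
  have c2 := sum_col_mul_col B 2 2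
  rw [Matrix.one_apply_eq] at r0 c1 c2
  have b01 : B.1 0 1 = 0 := by nlinarith
  have b02 : B.1 0 2 = 0 := by nlinarith
  rw [Matrix.det_fin_three, b00, b10, b20, b01, b02] at hdet
  rw [b01] at c1
  rw [b02] at c2
  have hsq : (B.1 2 2 - B.1 1 1) ^ 2 + (B.1 1 2 + B.1 2 1) ^ 2 = 0 := by linarith
  have b22 : B.1 2 2 = B.1 1 1 := by
    nlinarith [sq_nonneg (B.1 2 2 - B.1 1 1), sq_nonneg (B.1 1 2 + B.1 2 1)]
  have b12 : B.1 1 2 = -B.1 2 1 := by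
    nlinarith [sq_nonneg (B.1 2 2 - B.1 1 1), sq_nonneg (B.1 1 2 + B.1 2 1)]
  obtain ⟨a, b, hab, hc, hs⟩ := exists_half_angle (c := B.1 1 1) (s := B.1 2 1) (by linarith)
  refine ⟨unitQuaternion a b 0 0 (by linarith), Subtype.ext ?_⟩
  refine Eq.trans ?_ (Matrix.eta_fin_three B.1).symm
  rw [rot_unitQuaternion_axis, hc, hs, b00, b10, b20, b01, b02, b22, b12]

/-- Every rotation comes from a unit quaternion: first move the first axis to its image, then
rotate about this axis. -/
lemma exists_rot_eq {A : O 3} (hA : A.1.det = 1) : ∃ q, rot q = A := by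
  obtain ⟨q, hq0, hq1, hq2⟩ := exists_rot_first_column (u := A.1 0 0) (v := A.1 1 0) (w := A.1 2 0)
    (by have := sum_col_mul_col A 0 0; simp at this; linarith)
  have hBc : ∀ i, ((rot q)⁻¹ * A).1 i 0 = (1 : Matrix (Fin 3) (Fin 3) ℝ) i 0 := by
    intro i
    rw [← sum_col_mul_col (rot q) i 0, hq0, hq1, hq2]
    have : ((rot q)⁻¹ * A).1 i 0 = ∑ k, (rot q).1 k i * A.1 k 0 := rfl
    rw [this, Fin.sum_univ_three]
  have hBdet : ((rot q)⁻¹ * A).1.det = 1 := by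
    have h1 : A.1.det = (rotMatrix q).det * ((rot q)⁻¹ * A).1.det := by
      conv_lhs => rw [← mul_inv_cancel_left (rot q) A]
      exact Matrix.det_mul _ _
    rw [hA, det_rotMatrix, sum_sq_eq_one, one_pow, one_mul] at h1
    exact h1.symm
  obtain ⟨q', hq'⟩ := exists_rot_eq_of_first_column hBdet (by simpa using hBc 0)
    (by simpa using hBc 1) (by simpa using hBc 2)
  exact ⟨q * q', by rw [map_mul, hq', mul_inv_cancel_left]⟩

lemma finite_hyperoctahedral (n : ℕ) : (hyperoctahedral n : Set (O n)).Finite := by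
  refine (Set.finite_range fun x : Equiv.Perm (Fin n) × (Fin n → ℤˣ) =>
    (Matrix.of fun i j => if i = x.1 j then ((x.2 j : ℤ) : ℝ) else 0)).preimage
    Subtype.val_injective.injOn |>.subset ?_
  rintro A ⟨σ, ε, h⟩
  exact ⟨(σ, ε), Matrix.ext fun i j => (h i j).symm⟩

instance : T2Space (Frame 3) :=
  have : IsClosed (hyperoctahedral 3 : Set (O 3)) := (finite_hyperoctahedral 3).isClosed
  inferInstance

/-- The map sending a unit quaternion to the undirected frame obtained by rotating the standard
frame. -/
noncomputable def frameOfQuaternion (q : Metric.sphere (0 : ℍ) 1) : Frame 3 := (rot q : Frame 3)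

lemma frameOfQuaternion_surjective : Function.Surjective frameOfQuaternion := by
  intro x
  obtain ⟨A, rfl⟩ := QuotientGroup.mk_surjective x
  have hdet : A.1.det * A.1.det = 1 := by
    have h := congrArg Matrix.det ((Matrix.mem_orthogonalGroup_iff _ _).1 A.2)
    simpa using h
  rcases mul_self_eq_one_iff.1 hdet with h | h
  · obtain ⟨q, hq⟩ := exists_rot_eq h
    exact ⟨q, congrArg _ hq⟩
  · -- The central reflection `-1` is a signed permutation and reverses orientation.
    obtain ⟨q, hq⟩ := exists_rot_eq (A := -A) (by
      have : (-A).1 = -A.1 := rfl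
      rw [this, Matrix.det_neg, h]
      norm_num)
    refine ⟨q, QuotientGroup.eq.2 ⟨1, fun _ => -1, fun i j => ?_⟩⟩
    rw [hq, inv_neg, neg_mul, inv_mul_cancel]
    have : (-1 : O 3).1 i j = -(1 : Matrix (Fin 3) (Fin 3) ℝ) i j := rfl
    rw [this, Matrix.one_apply]
    by_cases hij : i = j <;> simp [hij]

/-- The space of undirected frames is the quotient of the sphere of unit quaternions by a finite
subgroup, so the sphere covers it. -/
theorem isCoveringMap_frameOfQuaternion : IsCoveringMap frameOfQuaternion := by
  have hcont : Continuous frameOfQuaternion := QuotientGroup.continuous_mk.comp continuous_rot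
  have hquot : IsQuotientMap frameOfQuaternion :=
    hcont.isClosedMap.isQuotientMap hcont frameOfQuaternion_surjective
  have hfin : ((hyperoctahedral 3).comap rot : Set (Metric.sphere (0 : ℍ) 1)).Finite := by
    refine (finite_hyperoctahedral 3).preimage' fun A _ => ?_
    rcases (rot ⁻¹' {A}).eq_empty_or_nonempty with h | ⟨q₀, hq₀⟩
    · rw [h]
      exact Set.finite_empty
    · refine (finite_ker_rot.image (q₀ * ·)).subset fun q hq => ⟨q₀⁻¹ * q, ?_, by simp⟩
      have h1 : rot q₀ = A := hq₀
      have h2 : rot q = A := hq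
      simp [MonoidHom.mem_ker, h1, h2]
  refine (hquot.isQuotientCoveringMap_of_subgroupOp _ hfin.isDiscrete fun {p q} => ?_).isCoveringMap
  rw [Subgroup.mem_comap, map_mul, map_inv]
  exact QuotientGroup.eq

end FrameField

/-! ### The ball minus a boundary point -/

section BallMinusPoint

variable {V : Type*} [NormedAddCommGroup V] [InnerProductSpace ℝ V] [FiniteDimensional ℝ V]

/-- The sphere minus a point `p` is homeomorphic to a vector space, hence an absolute extensor. In
particular, maps onto subsets `K` of it that are closed in `X` extend to `X`. -/
lemma exists_continuousOn_mapsTo_sphere_sdiff_singleton {p : V} (hp : ‖p‖ = 1) {X K : Set V}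
    (hKX : K ⊆ X) (hK : IsClosed ((Subtype.val : X → V) ⁻¹' K))
    (hKp : K ⊆ Metric.sphere 0 1 \ {p}) :
    ∃ r : V → V, ContinuousOn r X ∧ MapsTo r X (Metric.sphere 0 1 \ {p}) ∧ ∀ x ∈ K, r x = x := by
  have hcont : ContinuousOn (fun x : X => stereoToFun p (x : V)) (Subtype.val ⁻¹' K) := by
    refine (continuousOn_stereoToFun (v := p)).comp continuous_subtype_val.continuousOn ?_
    intro x hx
    have h1 := hKp hx
    have h2 : ‖(x : V)‖ = 1 := by simpa using h1.1
    exact ((inner_lt_one_iff_real_of_norm_eq_one hp h2).2 fun h => h1.2 h.symm).ne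
  obtain ⟨G, hG⟩ := hcont.exists_continuousMap_eqOn hK
  obtain ⟨r, hr, hrG⟩ := (continuous_subtype_val.comp
    ((continuous_stereoInvFun hp).comp G.continuous)).exists_continuousOn
  refine ⟨r, hr, fun x hx => ?_, fun x hx => ?_⟩
  · rw [hrG ⟨x, hx⟩]
    refine ⟨(stereoInvFun hp _).2, fun h => stereoInvFun_ne_north_pole hp _ (Subtype.ext h)⟩
  · rw [hrG ⟨x, hKX hx⟩, Function.comp_apply, Function.comp_apply, hG hx]
    exact congrArg Subtype.val (stereo_left_inv hp (x := ⟨x, (hKp hx).1⟩) fun h => (hKp hx).2 h)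

/-- Let `A` be a closed subset of the closed ball minus a boundary point `p` that contains no
boundary points. Then the ball minus `p` can be mapped into the complement of `A` by a map that is
the identity near the boundary, where `1 / 2 ≤ μ`: a retraction onto the boundary works off `A`, and
it is joined to the identity by segments, which near the boundary do not meet `A`. -/
lemma exists_push_off_of_isClosed {p : V} (hp : ‖p‖ = 1) {A : Set V}
    (hA : IsClosed ((Subtype.val : (Metric.closedBall (0 : V) 1 \ {p} : Set V) → V) ⁻¹' A))
    (hAs : ∀ x ∈ A, ‖x‖ = 1 → x = p) :
    ∃ (h : V → V) (μ : V → ℝ), ContinuousOn h (Metric.closedBall (0 : V) 1 \ {p}) ∧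
      ContinuousOn μ (Metric.closedBall (0 : V) 1 \ {p}) ∧
      MapsTo h (Metric.closedBall (0 : V) 1 \ {p}) ((Metric.closedBall (0 : V) 1 \ {p}) \ A) ∧
      (∀ x ∈ Metric.closedBall (0 : V) 1 \ {p}, 1 / 2 ≤ μ x → h x = x) ∧
      (∀ x ∈ Metric.closedBall (0 : V) 1 \ {p}, ‖x‖ = 1 → μ x = 1) ∧
      ∀ x ∈ Metric.closedBall (0 : V) 1 \ {p}, x ∈ A → μ x = 0 := by
  set X : Set V := Metric.closedBall (0 : V) 1 \ {p} with hX
  have hXconv : Convex ℝ X := by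
    have h := StrictConvexSpace.sphere_subset_extremePoints_closedBall (0 : V) one_ne_zero
      (show p ∈ Metric.sphere (0 : V) 1 by simpa using hp)
    exact ((convex_closedBall (0 : V) 1).mem_extremePoints_iff_convex_sdiff.1 h).2
  have hsX : Metric.sphere (0 : V) 1 \ {p} ⊆ X :=
    sdiff_subset_sdiff_left Metric.sphere_subset_closedBall
  have hZ : IsClosed ((Subtype.val : X → V) ⁻¹' (Metric.sphere (0 : V) 1 \ {p})) := by
    have : (Subtype.val : X → V) ⁻¹' (Metric.sphere (0 : V) 1 \ {p}) =
        Subtype.val ⁻¹' (Metric.sphere (0 : V) 1) := by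
      ext x
      exact ⟨fun h => h.1, fun h => ⟨h, x.2.2⟩⟩
    rw [this]
    exact Metric.isClosed_sphere.preimage continuous_subtype_val
  obtain ⟨r, hr, hrs, hrid⟩ := exists_continuousOn_mapsTo_sphere_sdiff_singleton hp hsX hZ le_rfl
  have hrX : Continuous fun x : X => r x := continuousOn_iff_continuous_domRestrict.1 hr
  let g : X × unitInterval → X := fun z => ⟨AffineMap.lineMap (r z.1) (z.1 : V) (z.2 : ℝ),
    hXconv.lineMap_mem (hsX (hrs z.1.2)) z.1.2 z.2.2⟩
  have hg : Continuous g := by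
    refine Continuous.subtype_mk ?_ _
    simp only [AffineMap.lineMap_apply_module]
    have h1 : Continuous fun z : X × unitInterval => r z.1 := hrX.comp continuous_fst
    have h2 : Continuous fun z : X × unitInterval => (z.2 : ℝ) :=
      continuous_subtype_val.comp continuous_snd
    exact ((continuous_const.sub h2).smul h1).add
      (h2.smul (continuous_subtype_val.comp continuous_fst))
  -- The points whose segment meets `A`.
  let N : Set X := Prod.fst '' (g ⁻¹' (Subtype.val ⁻¹' A))
  have hN : IsClosed N := isClosedMap_fst_of_compactSpace _ (hA.preimage hg)
  have hdisj : Disjoint N (Subtype.val ⁻¹' (Metric.sphere (0 : V) 1 \ {p})) := by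
    rw [Set.disjoint_left]
    rintro _ ⟨⟨x, t⟩, hxt, rfl⟩ hx
    have h1 : (g (x, t) : V) = x := by
      simp only [g, hrid x hx, AffineMap.lineMap_same, AffineMap.const_apply]
    have h2 : (g (x, t) : V) ∈ A := hxt
    rw [h1] at h2
    exact x.2.2 (hAs x h2 (by simpa using hx.1))
  obtain ⟨μ, hμ0, hμ1, -⟩ := exists_continuous_zero_one_of_isClosed hN hZ hdisj
  let t : X → unitInterval := fun x => projIcc 0 1 zero_le_one (2 * μ x)
  have ht : Continuous t := continuous_projIcc.comp (by fun_prop)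
  obtain ⟨h, hh, hhe⟩ := (continuous_subtype_val.comp
    (hg.comp (continuous_id.prodMk ht))).exists_continuousOn
  obtain ⟨μ', hμ', hμe⟩ := μ.continuous.exists_continuousOn
  refine ⟨h, μ', hh, hμ', fun x hx => ?_, fun x hx hx2 => ?_, fun x hx hx1 => ?_,
    fun x hx hxA => ?_⟩
  · rw [hhe ⟨x, hx⟩]
    refine ⟨(g _).2, fun hmem => ?_⟩
    have hxN : (⟨x, hx⟩ : X) ∈ N := ⟨(_, _), hmem, rfl⟩
    have h0 : t ⟨x, hx⟩ = 0 := by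
      have h1 : μ ⟨x, hx⟩ = 0 := hμ0 hxN
      simp only [t, h1, mul_zero]
      exact projIcc_left zero_le_one
    have h1 : (g (⟨x, hx⟩, t ⟨x, hx⟩) : V) = r x := by
      simp [g, h0]
    have h2 : (g (⟨x, hx⟩, t ⟨x, hx⟩) : V) ∈ A := hmem
    rw [h1] at h2
    exact (hrs hx).2 (hAs _ h2 (by simpa using (hrs hx).1))
  · rw [hμe ⟨x, hx⟩] at hx2
    have h1 : t ⟨x, hx⟩ = 1 := projIcc_of_right_le zero_le_one (by linarith)
    rw [hhe ⟨x, hx⟩]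
    simp [g, h1]
  · rw [hμe ⟨x, hx⟩]
    exact hμ1 ⟨by simpa using hx1, hx.2⟩
  · rw [hμe ⟨x, hx⟩]
    refine hμ0 ⟨(⟨x, hx⟩, 1), ?_, rfl⟩
    simpa [g] using hxA

lemma mem_closure_sphere_sdiff_singleton (hdim : 1 < Module.finrank ℝ V) {p : V} (hp : ‖p‖ = 1) :
    p ∈ closure (Metric.sphere (0 : V) 1 \ {p}) := by
  have hps : p ∈ Metric.sphere (0 : V) 1 := by simpa using hp
  have hrank : 1 < Module.rank ℝ V := by
    rw [← Module.finrank_eq_rank]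
    exact_mod_cast hdim
  have hnt : (Metric.sphere (0 : V) 1).Nontrivial := by
    refine ⟨p, hps, -p, by simpa using hp, fun h => ?_⟩
    exact ne_neg_of_mem_unit_sphere ℝ (⟨p, hps⟩ : Metric.sphere (0 : V) 1) (Subtype.ext h)
  have h := (isPreconnected_sphere hrank (0 : V) 1).preperfect_of_nontrivial hnt p hps
  rwa [accPt_principal_iff_clusterPt, ← mem_closure_iff_clusterPt] at h

end BallMinusPoint

/-! ### Extending frame fields from the sphere -/

namespace FrameField

/-- A continuous field of undirected frames on the unit sphere extends to the whole space: it lifts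
to a map into the sphere of unit quaternions, and `π₂` of this three-dimensional sphere is
trivial. -/
theorem exists_continuous_extension_of_sphere {u : E 3 → Frame 3}
    (hu : ContinuousOn u (Metric.sphere 0 1)) :
    ∃ U : E 3 → Frame 3, Continuous U ∧ EqOn U u (Metric.sphere 0 1) := by
  have h3 : Module.finrank ℝ (E 3) = 3 := by simp
  obtain ⟨F, hF⟩ := isCoveringMap_frameOfQuaternion.exists_lift_sphere frameOfQuaternion_surjective
    (V := E 3) (by omega) ⟨_, continuousOn_iff_continuous_domRestrict.1 hu⟩
  obtain ⟨L, hL, hLF⟩ := (continuous_subtype_val.comp F.continuous).exists_continuousOn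
  obtain ⟨G, hG, hGL, hG1⟩ := hL.exists_extension_norm_eq_one
    (by rw [h3, Quaternion.finrank_eq_four]; norm_num) Metric.isClosed_sphere
    (fun x hx => by rw [hLF ⟨x, hx⟩]; exact norm_eq_of_mem_sphere _)
  have hGs : ∀ x, G x ∈ Metric.sphere (0 : Quaternion ℝ) 1 := fun x => by simp [hG1 x]
  refine ⟨fun x => frameOfQuaternion ⟨G x, hGs x⟩,
    isCoveringMap_frameOfQuaternion.continuous.comp (hG.subtype_mk hGs), fun x hx => ?_⟩
  have h1 : (⟨G x, hGs x⟩ : Metric.sphere (0 : Quaternion ℝ) 1) = F ⟨x, hx⟩ := by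
    refine Subtype.ext ?_
    change G x = F ⟨x, hx⟩
    rw [hGL hx, hLF ⟨x, hx⟩]
    rfl
  exact (congrArg frameOfQuaternion h1).trans (hF ⟨x, hx⟩)

/-! ### Relative interiors and gluing -/

section RelInterior

variable {n : ℕ} {M C : Set (E n)}

lemma relInterior_eq_inter (M C : Set (E n)) : ∃ U, IsOpen U ∧ relInterior M C = M ∩ U := by
  obtain ⟨U, hU, h⟩ := isOpen_induced_iff.1 (isOpen_interior (s := (Subtype.val : M → E n) ⁻¹' C))
  refine ⟨U, hU, ?_⟩
  rw [relInterior, ← h, Subtype.image_preimage_coe]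

lemma mem_relInterior_iff {x : E n} : x ∈ relInterior M C ↔ x ∈ M ∧ C ∈ 𝓝[M] x := by
  constructor
  · rintro ⟨y, hy, rfl⟩
    exact ⟨y.2, preimage_coe_mem_nhds_subtype.1 (mem_interior_iff_mem_nhds.1 hy)⟩
  · rintro ⟨hx, hC⟩
    exact ⟨⟨x, hx⟩, mem_interior_iff_mem_nhds.2 (preimage_coe_mem_nhds_subtype.2 hC), rfl⟩

lemma relInterior_subset : relInterior M C ⊆ C := fun _ hx =>
  mem_of_mem_nhdsWithin (mem_relInterior_iff.1 hx).1 (mem_relInterior_iff.1 hx).2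

lemma interior_subset_relInterior (hCM : C ⊆ M) : interior C ⊆ relInterior M C := fun _ hx =>
  mem_relInterior_iff.2 ⟨hCM (interior_subset hx),
    mem_nhdsWithin_of_mem_nhds (mem_interior_iff_mem_nhds.1 hx)⟩

lemma mem_frontier_of_mem_bdry {x : E n} (hCM : C ⊆ M) (hx : x ∈ bdry M) (hxC : x ∈ C) :
    x ∈ frontier C :=
  ⟨subset_closure hxC, fun h => hx.2 (interior_mono hCM h)⟩

lemma mem_frontier_of_notMem_relInterior {x : E n} (hCM : C ⊆ M) (hxC : x ∈ C)
    (hx : x ∉ relInterior M C) : x ∈ frontier C :=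
  ⟨subset_closure hxC, fun h => hx (interior_subset_relInterior hCM h)⟩

/-- To remove the singularities in `P`, it is enough to find a frame field `g` on `C` that agrees
with `f` on the part of `C` outside its relative interior. -/
lemma redundantVia_of_eq_on_boundary {S P : Set (E n)} {f g : E n → Frame n}
    (hf : IsFrameField M S f) (hCM : C ⊆ M) (hC : IsClosed C) (hP : P ⊆ relInterior M C)
    (hg : ContinuousOn g (C ∩ ((M \ S) ∪ relInterior M C)))
    (hgf : ∀ x ∈ C, x ∉ relInterior M C → x ∉ S → g x = f x)
    (hal : BoundaryAligned M (M \ S) f → ∀ x ∈ bdry M ∩ relInterior M C, HasNormalAxis M x (g x)) :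
    RedundantVia M S f P C := by
  classical
  set R := relInterior M C with hR
  let f' : E n → Frame n := fun x => if x ∈ R then g x else f x
  have hf'R : ∀ x ∈ R, f' x = g x := fun x hx => if_pos hx
  have hf'n : ∀ x ∉ R, f' x = f x := fun x hx => if_neg hx
  refine ⟨⟨hCM, hC.preimage continuous_subtype_val⟩, hP, f', ?_, fun x hx => hf'n x hx.2, ?_⟩
  · -- The domain is covered by its intersection with `C` and the complement of `R`, both closed.
    obtain ⟨U, hU, hRU⟩ := relInterior_eq_inter M C
    have hcover : (M \ S) ∪ R = (C ∩ ((M \ S) ∪ R)) ∪ ((M \ S) \ R) := by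
      ext x
      by_cases hxR : x ∈ R
      · simp [hxR, relInterior_subset hxR]
      · simp [hxR]
    have hf'C : EqOn f' g (C ∩ ((M \ S) ∪ R)) := by
      intro x hx
      by_cases hxR : x ∈ R
      · exact hf'R x hxR
      · rw [hf'n x hxR, hgf x hx.1 hxR (hx.2.resolve_right hxR).2]
    intro x hx
    rw [hcover, continuousWithinAt_union]
    constructor
    · by_cases hxC : x ∈ C
      · exact (hg x ⟨hxC, hx⟩).congr hf'C (hf'C ⟨hxC, hx⟩)
      · exact continuousWithinAt_of_notMem_closure fun h =>
          hxC (closure_minimal inter_subset_left hC h)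
    · by_cases hxR : x ∈ R
      · refine continuousWithinAt_of_notMem_closure fun h => ?_
        have hsub : (M \ S) \ R ⊆ Uᶜ := fun y hy hyU => hy.2 (by
          rw [hR, hRU]
          exact ⟨hy.1.1, hyU⟩)
        refine closure_minimal hsub hU.isClosed_compl h ?_
        rw [hR, hRU] at hxR
        exact hxR.2
      · exact ((hf x (hx.resolve_right hxR)).mono sdiff_subset).congr (fun y hy => hf'n y hy.2)
          (hf'n x hxR)
  · intro hfal x hx
    by_cases hxR : x ∈ R
    · rw [hf'R x hxR]
      exact hal hfal x ⟨hx.1, hxR⟩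
    · rw [hf'n x hxR]
      exact hfal x ⟨hx.1, hx.2.resolve_right hxR⟩

end RelInterior

/-! ### Parametrized balls -/

/-- A parametrization of a subset `B` of Euclidean space by the closed unit ball, together with the
topological description of its boundary: `toFun` and `invFun` are mutually inverse homeomorphisms
between the closed ball and `B`, given as functions on the ambient space. -/
structure BallParam (n : ℕ) (B : Set (E n)) where
  /-- The homeomorphism from the closed unit ball. -/
  toFun : E n → E n
  /-- The homeomorphism to the closed unit ball. -/
  invFun : E n → E n
  continuousOn_toFun : ContinuousOn toFun (Metric.closedBall 0 1)
  continuousOn_invFun : ContinuousOn invFun B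
  mapsTo_toFun : MapsTo toFun (Metric.closedBall 0 1) B
  mapsTo_invFun : MapsTo invFun B (Metric.closedBall 0 1)
  left_inv : ∀ x ∈ Metric.closedBall (0 : E n) 1, invFun (toFun x) = x
  right_inv : ∀ y ∈ B, toFun (invFun y) = y

namespace BallParam

variable {n : ℕ} {B : Set (E n)} (e : BallParam n B)

include e

lemma image_closedBall : e.toFun '' Metric.closedBall 0 1 = B :=
  e.mapsTo_toFun.image_subset.antisymm fun y hy =>
    ⟨e.invFun y, e.mapsTo_invFun hy, e.right_inv y hy⟩

lemma isCompact : IsCompact B := by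
  rw [← e.image_closedBall]
  exact (isCompact_closedBall 0 1).image_of_continuousOn e.continuousOn_toFun

lemma frontier_subset : frontier B ⊆ B := e.isCompact.isClosed.frontier_subset

lemma mem_frontier_iff {y : E n} (hy : y ∈ B) : y ∈ frontier B ↔ ‖e.invFun y‖ = 1 := by
  have h1 := mem_interior_iff_norm_lt_one e.continuousOn_toFun e.continuousOn_invFun e.mapsTo_toFun
    e.mapsTo_invFun e.left_inv e.right_inv (e.mapsTo_invFun hy)
  rw [e.right_inv y hy] at h1
  have h2 : ‖e.invFun y‖ ≤ 1 := by simpa using e.mapsTo_invFun hy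
  rw [frontier, mem_sdiff, h1, not_lt]
  exact ⟨fun h => le_antisymm h2 h.2, fun h => ⟨subset_closure hy, h.ge⟩⟩

lemma toFun_mem_frontier {x : E n} (hx : ‖x‖ = 1) : e.toFun x ∈ frontier B := by
  have hx' : x ∈ Metric.closedBall (0 : E n) 1 := by simpa using hx.le
  rw [e.mem_frontier_iff (e.mapsTo_toFun hx'), e.left_inv x hx', hx]

end BallParam

lemma IsClosedBall.nonempty_ballParam {n : ℕ} {B : Set (E n)} (hB : IsClosedBall B) :
    Nonempty (BallParam n B) := by
  obtain ⟨e⟩ := hB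
  obtain ⟨φ, ψ, h1, h2, h3, h4, h5, h6⟩ := e.symm.exists_continuousOn_invOn
  exact ⟨⟨φ, ψ, h1, h2, h3, h4, h5, h6⟩⟩

/-! ### Removing the singularities in a ball -/

section Main

variable {M S B : Set (E 3)} {f : E 3 → Frame 3}

/-- If at most one boundary point of the ball `B` is singular, then `f` extends from the rest of the
boundary to `B` without that point. -/
lemma BallParam.exists_extension_of_subsingleton (e : BallParam 3 B) (hf : IsFrameField M S f)
    (hBM : B ⊆ M) (hsing : (frontier B ∩ S).Subsingleton) :
    ∃ g : E 3 → Frame 3, ContinuousOn g (B \ (frontier B ∩ S)) ∧ EqOn g f (frontier B \ S) := by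
  rcases (frontier B ∩ S).eq_empty_or_nonempty with hempty | ⟨y₀, hy₀, hy₀S⟩
  · have hmaps : MapsTo e.toFun (Metric.sphere 0 1) (M \ S) := by
      intro x hx
      have hfr := e.toFun_mem_frontier (x := x) (by simpa using hx)
      exact ⟨hBM (e.frontier_subset hfr), fun hS => notMem_empty _ (hempty.subset ⟨hfr, hS⟩)⟩
    obtain ⟨U, hU, hUf⟩ := exists_continuous_extension_of_sphere (u := fun x => f (e.toFun x))
      (hf.comp (e.continuousOn_toFun.mono Metric.sphere_subset_closedBall) hmaps)
    refine ⟨fun y => U (e.invFun y),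
      hU.comp_continuousOn (e.continuousOn_invFun.mono sdiff_subset), fun y hy => ?_⟩
    have hyB := e.frontier_subset hy.1
    change U (e.invFun y) = f y
    exact (hUf (by simpa using (e.mem_frontier_iff hyB).1 hy.1)).trans
      (congrArg f (e.right_inv y hyB))
  · have hy₀B := e.frontier_subset hy₀
    have hp : ‖e.invFun y₀‖ = 1 := (e.mem_frontier_iff hy₀B).1 hy₀
    obtain ⟨r, hr, hrs, hrid⟩ := exists_continuousOn_mapsTo_sphere_sdiff_singleton hp
      (X := Metric.closedBall 0 1 \ {e.invFun y₀}) (K := Metric.sphere 0 1 \ {e.invFun y₀})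
      (sdiff_subset_sdiff_left Metric.sphere_subset_closedBall) (by
        have : (Subtype.val : (Metric.closedBall (0 : E 3) 1 \ {e.invFun y₀} : Set (E 3)) → E 3) ⁻¹'
            (Metric.sphere (0 : E 3) 1 \ {e.invFun y₀}) =
            Subtype.val ⁻¹' (Metric.sphere (0 : E 3) 1) := by
          ext x
          exact ⟨fun h => h.1, fun h => ⟨h, x.2.2⟩⟩
        rw [this]
        exact Metric.isClosed_sphere.preimage continuous_subtype_val) le_rfl
    have hinv : MapsTo e.invFun (B \ (frontier B ∩ S)) (Metric.closedBall 0 1 \ {e.invFun y₀}) := by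
      intro y hy
      refine ⟨e.mapsTo_invFun hy.1, fun h => hy.2 ?_⟩
      have : y = y₀ := by rw [← e.right_inv y hy.1, h, e.right_inv y₀ hy₀B]
      exact this ▸ ⟨hy₀, hy₀S⟩
    have hmaps : MapsTo e.toFun (Metric.sphere 0 1 \ {e.invFun y₀}) (M \ S) := by
      intro x hx
      have hx1 : ‖x‖ = 1 := by simpa using hx.1
      have hfr := e.toFun_mem_frontier hx1
      refine ⟨hBM (e.frontier_subset hfr), fun hS => hx.2 ?_⟩
      have h1 : e.toFun x = y₀ := hsing ⟨hfr, hS⟩ ⟨hy₀, hy₀S⟩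
      rw [mem_singleton_iff, ← h1, e.left_inv x (by simpa using hx1.le)]
    refine ⟨fun y => f (e.toFun (r (e.invFun y))), ?_, fun y hy => ?_⟩
    · exact hf.comp (e.continuousOn_toFun.comp (hr.comp (e.continuousOn_invFun.mono sdiff_subset)
        hinv) fun y hy => Metric.sphere_subset_closedBall (hrs (hinv hy)).1)
        fun y hy => hmaps (hrs (hinv hy))
    · have hyB := e.frontier_subset hy.1
      have hy1 : e.invFun y ∈ Metric.sphere (0 : E 3) 1 \ {e.invFun y₀} :=
        ⟨by simpa using (e.mem_frontier_iff hyB).1 hy.1, (hinv ⟨hyB, fun h => hy.2 h.2⟩).2⟩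
      change f (e.toFun (r (e.invFun y))) = f y
      rw [hrid _ hy1, e.right_inv y hyB]

/-- If no singularity lies on the boundary of `B` and in its relative interior, then all
singularities in the interior of `B` can be removed. Boundary alignment is preserved because `f` is
not changed on the boundary of `B`, which contains all points of `∂M` in `B`. -/
lemma BallParam.redundantVia_of_inter_eq_empty (e : BallParam 3 B) (hf : IsFrameField M S f)
    (hBM : B ⊆ M) (hsing : (frontier B ∩ S).Subsingleton) {P : Set (E 3)} (hPB : P ⊆ interior B)
    (hempty : frontier B ∩ S ∩ relInterior M B = ∅) : RedundantVia M S f P B := by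
  obtain ⟨g, hg, hgf⟩ := e.exists_extension_of_subsingleton hf hBM hsing
  have hR : ∀ x ∈ relInterior M B, x ∈ frontier B → x ∉ S := fun x hxR hxf hxS =>
    notMem_empty _ (hempty.subset ⟨⟨hxf, hxS⟩, hxR⟩)
  refine redundantVia_of_eq_on_boundary hf hBM e.isCompact.isClosed
    (hPB.trans (interior_subset_relInterior hBM)) (hg.mono fun x hx => ⟨hx.1, fun h => ?_⟩)
    (fun x hxB hxR hxS => hgf ⟨mem_frontier_of_notMem_relInterior hBM hxB hxR, hxS⟩)
    fun hal x hx => ?_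
  · rcases hx.2 with h1 | h1
    · exact h1.2 h.2
    · exact hR x h1 h.1 h.2
  · have hxB := relInterior_subset hx.2
    have hfr := mem_frontier_of_mem_bdry hBM hx.1 hxB
    have hxS := hR x hx.2 hfr
    rw [hgf ⟨hfr, hxS⟩]
    exact hal x ⟨hx.1, hBM hxB, hxS⟩

/-- Without boundary alignment, a singularity on the boundary of `B` that lies in the relative
interior of `B` is removed together with those in the interior. -/
lemma BallParam.redundantVia_of_not_boundaryAligned (e : BallParam 3 B) (hf : IsFrameField M S f)
    (hBM : B ⊆ M) (hsing : (frontier B ∩ S).Subsingleton) {P : Set (E 3)} (hPB : P ⊆ interior B)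
    {y₀ : E 3} (hy₀ : y₀ ∈ frontier B ∩ S) (hy₀R : y₀ ∈ relInterior M B)
    (hal : ¬ BoundaryAligned M (M \ S) f) : RedundantVia M S f P B := by
  have hy₀B := e.frontier_subset hy₀.1
  have hp : ‖e.invFun y₀‖ = 1 := (e.mem_frontier_iff hy₀B).1 hy₀.1
  obtain ⟨U, hU, hRU⟩ := relInterior_eq_inter M B
  have hBR : B \ relInterior M B = B \ U := by
    rw [hRU]
    ext x
    exact ⟨fun h => ⟨h.1, fun hx => h.2 ⟨hBM h.1, hx⟩⟩, fun h => ⟨h.1, fun hx => h.2 hx.2⟩⟩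
  have hK : IsCompact (e.invFun '' (B \ relInterior M B)) := by
    rw [hBR]
    exact (e.isCompact.diff hU).image_of_continuousOn (e.continuousOn_invFun.mono sdiff_subset)
  obtain ⟨r, hr, hrs, hrid⟩ := exists_continuousOn_mapsTo_sphere_sdiff_singleton hp
    (X := Metric.closedBall 0 1) (K := e.invFun '' (B \ relInterior M B))
    ((image_mono sdiff_subset).trans e.mapsTo_invFun.image_subset)
    (hK.isClosed.preimage continuous_subtype_val) (by
      rintro _ ⟨y, hy, rfl⟩
      have h1 : ‖e.invFun y‖ = 1 := (e.mem_frontier_iff hy.1).1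
        (mem_frontier_of_notMem_relInterior hBM hy.1 hy.2)
      refine ⟨by simpa using h1, fun h => hy.2 ?_⟩
      have : y = y₀ := by rw [← e.right_inv y hy.1, h, e.right_inv y₀ hy₀B]
      rwa [this])
  have hmaps : MapsTo e.toFun (Metric.sphere 0 1 \ {e.invFun y₀}) (M \ S) := by
    intro x hx
    have hx1 : ‖x‖ = 1 := by simpa using hx.1
    have hfr := e.toFun_mem_frontier hx1
    refine ⟨hBM (e.frontier_subset hfr), fun hS => hx.2 ?_⟩
    have h1 : e.toFun x = y₀ := hsing ⟨hfr, hS⟩ hy₀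
    rw [mem_singleton_iff, ← h1, e.left_inv x (by simpa using hx1.le)]
  refine redundantVia_of_eq_on_boundary (g := fun y => f (e.toFun (r (e.invFun y)))) hf hBM
    e.isCompact.isClosed (hPB.trans (interior_subset_relInterior hBM)) ?_
    (fun x hxB hxR hxS => ?_) fun h => absurd h hal
  · refine ContinuousOn.mono (s := B) ?_ inter_subset_left
    exact hf.comp (e.continuousOn_toFun.comp (hr.comp e.continuousOn_invFun e.mapsTo_invFun)
      fun y hy => Metric.sphere_subset_closedBall (hrs (e.mapsTo_invFun hy)).1)
      fun y hy => hmaps (hrs (e.mapsTo_invFun hy))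
  · rw [hrid _ (mem_image_of_mem _ ⟨hxB, hxR⟩), e.right_inv x hxB]

/-- If `S` is closed, a singularity `y₀` on the boundary of `B` is kept: the singularities in the
interior are enclosed in a closed subset `C` of `B` that meets the boundary of `B` in `y₀` only. As
`y₀` is not in the relative interior of `C`, the frame field is not changed on `∂M`. -/
lemma BallParam.exists_redundantVia_of_isClosedIn (e : BallParam 3 B) (hf : IsFrameField M S f)
    (hBM : B ⊆ M) (hsing : (frontier B ∩ S).Subsingleton) {P : Set (E 3)} (hPS : P ⊆ S)
    (hPB : P ⊆ interior B) {y₀ : E 3} (hy₀ : y₀ ∈ frontier B ∩ S) (hS : IsClosedIn M S) :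
    ∃ C ⊆ B, RedundantVia M S f P C := by
  have hy₀B := e.frontier_subset hy₀.1
  set p := e.invFun y₀ with hpdef
  have hp : ‖p‖ = 1 := (e.mem_frontier_iff hy₀B).1 hy₀.1
  have hpB : p ∈ Metric.closedBall (0 : E 3) 1 := e.mapsTo_invFun hy₀B
  have hep : e.toFun p = y₀ := e.right_inv y₀ hy₀B
  set X : Set (E 3) := Metric.closedBall 0 1 \ {p} with hX
  have hA : IsClosed ((Subtype.val : X → E 3) ⁻¹' (e.toFun ⁻¹' S)) := by
    have hc : Continuous fun x : X => e.toFun x :=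
      continuousOn_iff_continuous_domRestrict.1 (e.continuousOn_toFun.mono sdiff_subset)
    exact hS.2.preimage (hc.subtype_mk fun x => hBM (e.mapsTo_toFun x.2.1))
  obtain ⟨h, μ, hh, hμ, hmaps, hid, hμ1, hμ0⟩ := exists_push_off_of_isClosed hp hA
    (fun x hx hx1 => by
      have h1 : e.toFun x = y₀ := hsing ⟨e.toFun_mem_frontier hx1, hx⟩ hy₀
      rw [hpdef, ← h1, e.left_inv x (by simpa using hx1.le)])
  have hinvX : ∀ y ∈ B, y ≠ y₀ → e.invFun y ∈ X := fun y hy hne =>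
    ⟨e.mapsTo_invFun hy, fun h => hne (by rw [← e.right_inv y hy, h, hep])⟩
  have hμX : Continuous fun x : X => μ x := continuousOn_iff_continuous_domRestrict.1 hμ
  obtain ⟨T, hT, hTμ⟩ := isClosed_induced_iff.1
    (isClosed_le hμX (continuous_const (y := (1 / 2 : ℝ))))
  obtain ⟨O, hO, hOμ⟩ := isOpen_induced_iff.1
    (isOpen_lt hμX (continuous_const (y := (1 / 2 : ℝ))))
  have hTiff : ∀ x ∈ X, x ∈ T ↔ μ x ≤ 1 / 2 := fun x hx =>
    Set.ext_iff.1 hTμ ⟨x, hx⟩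
  have hOiff : ∀ x ∈ X, x ∈ O ↔ μ x < 1 / 2 := fun x hx =>
    Set.ext_iff.1 hOμ ⟨x, hx⟩
  set C := e.toFun '' (Metric.closedBall 0 1 ∩ (T ∪ {p})) with hCdef
  have hCB : C ⊆ B := by
    rintro _ ⟨x, hx, rfl⟩
    exact e.mapsTo_toFun hx.1
  have hCM : C ⊆ M := hCB.trans hBM
  have hCc : IsCompact C := ((isCompact_closedBall 0 1).inter_right
    (hT.union isClosed_singleton)).image_of_continuousOn
      (e.continuousOn_toFun.mono inter_subset_left)
  have hCiff : ∀ y ∈ C, y ≠ y₀ → μ (e.invFun y) ≤ 1 / 2 := by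
    rintro _ ⟨x, ⟨hx, hxT⟩, rfl⟩ hne
    rw [e.left_inv x hx]
    have hxp : x ≠ p := fun h => hne (by rw [h, hep])
    exact (hTiff x ⟨hx, hxp⟩).1 (hxT.resolve_right hxp)
  have hfrC : ∀ y ∈ frontier B, y ∈ C → y = y₀ := by
    intro y hy hyC
    by_contra hne
    have hyB := hCB hyC
    have h1 := hCiff y hyC hne
    rw [hμ1 _ (hinvX y hyB hne) ((e.mem_frontier_iff hyB).1 hy)] at h1
    norm_num at h1
  -- The points where `μ < 1 / 2` form an open set.
  have hint : ∀ y ∈ B, y ≠ y₀ → μ (e.invFun y) < 1 / 2 → y ∈ relInterior M C := by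
    intro y hyB hne hy
    have hopen : IsOpen (interior B ∩ e.invFun ⁻¹' O) :=
      (e.continuousOn_invFun.mono interior_subset).isOpen_inter_preimage isOpen_interior hO
    have hyint : y ∈ interior B := by
      by_contra hn
      have h1 := hμ1 _ (hinvX y hyB hne)
        ((e.mem_frontier_iff hyB).1 ⟨subset_closure hyB, hn⟩)
      rw [h1] at hy
      norm_num at hy
    refine interior_subset_relInterior hCM (interior_maximal ?_ hopen
      ⟨hyint, (hOiff _ (hinvX y hyB hne)).2 hy⟩)
    intro z hz
    have hzB := interior_subset hz.1
    have hzne : z ≠ y₀ := fun h => hy₀.1.2 (h ▸ hz.1)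
    have hzX := hinvX z hzB hzne
    exact ⟨e.invFun z, ⟨hzX.1, Or.inl ((hTiff _ hzX).2 ((hOiff _ hzX).1 hz.2).le)⟩,
      e.right_inv z hzB⟩
  have hy₀C : y₀ ∉ relInterior M C := by
    intro hy
    have hcl : p ∈ closure (Metric.sphere (0 : E 3) 1 \ {p}) :=
      mem_closure_sphere_sdiff_singleton (by simp) hp
    have h1 : y₀ ∈ closure (e.toFun '' (Metric.sphere (0 : E 3) 1 \ {p})) := by
      rw [← hep]
      exact ((e.continuousOn_toFun p hpB).mono
        (sdiff_subset.trans Metric.sphere_subset_closedBall)).mem_closure_image hcl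
    rw [mem_closure_iff_nhdsWithin_neBot] at h1
    have h2 : e.toFun '' (Metric.sphere (0 : E 3) 1 \ {p}) ⊆ M := by
      rintro _ ⟨x, hx, rfl⟩
      exact hBM (e.mapsTo_toFun (Metric.sphere_subset_closedBall hx.1))
    obtain ⟨_, ⟨x, hx, rfl⟩, hxC⟩ := h1.nonempty_of_mem (Filter.inter_mem self_mem_nhdsWithin
      (nhdsWithin_mono _ h2 (mem_relInterior_iff.1 hy).2))
    have hx1 : ‖x‖ = 1 := by simpa using hx.1
    refine hx.2 ?_
    rw [mem_singleton_iff, hpdef, ← hfrC _ (e.toFun_mem_frontier hx1) hxC,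
      e.left_inv x (by simpa using hx1.le)]
  refine ⟨C, hCB, redundantVia_of_eq_on_boundary (g := fun y => f (e.toFun (h (e.invFun y)))) hf hCM
    hCc.isClosed (fun y hy => ?_) ?_ (fun y hyC hyR hyS => ?_) fun _ y hy => ?_⟩
  · have hyB := interior_subset (hPB hy)
    have hne : y ≠ y₀ := fun h => hy₀.1.2 (h ▸ hPB hy)
    refine hint y hyB hne ?_
    rw [hμ0 _ (hinvX y hyB hne) (by
      rw [mem_preimage, e.right_inv y hyB]
      exact hPS hy)]
    norm_num
  · have hsub : C ∩ ((M \ S) ∪ relInterior M C) ⊆ B \ {y₀} := by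
      rintro y ⟨hyC, hy⟩
      refine ⟨hCB hyC, fun h => ?_⟩
      rw [mem_singleton_iff] at h
      subst h
      exact hy.elim (fun h => h.2 hy₀.2) hy₀C
    refine ContinuousOn.mono ?_ hsub
    have hinv : MapsTo e.invFun (B \ {y₀}) X := fun y hy => hinvX y hy.1 hy.2
    exact hf.comp (e.continuousOn_toFun.comp (hh.comp (e.continuousOn_invFun.mono sdiff_subset)
      hinv) fun y hy => (hmaps (hinv hy)).1.1)
      fun y hy => ⟨hBM (e.mapsTo_toFun (hmaps (hinv hy)).1.1), (hmaps (hinv hy)).2⟩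
  · have hne : y ≠ y₀ := fun h => hyS (h ▸ hy₀.2)
    have hyB := hCB hyC
    have h1 : 1 / 2 ≤ μ (e.invFun y) := not_lt.1 fun h => hyR (hint y hyB hne h)
    change f (e.toFun (h (e.invFun y))) = f y
    rw [hid _ (hinvX y hyB hne) h1, e.right_inv y hyB]
  · have hyC := relInterior_subset hy.2
    have := hfrC y (mem_frontier_of_mem_bdry hBM hy.1 (hCB hyC)) hyC
    exact absurd (this ▸ hy.2) hy₀C

end Main

end FrameField

theorem mainTheorem6 (M S : Set (FrameField.E 3)) (hM : FrameField.IsSmoothDomain M) (hS : S ⊆ M)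
    (f : FrameField.E 3 → FrameField.Frame 3) (hf : FrameField.IsFrameField M S f)
    (B P : Set (FrameField.E 3)) (hB : FrameField.IsClosedBall B) (hBM : B ⊆ M)
    (hPS : P ⊆ S) (hPB : P ⊆ interior B)
    (hsing : (frontier B ∩ S).Subsingleton)
    (hclosed : FrameField.BoundaryAligned M (M \ S) f →
      (frontier B ∩ S ∩ FrameField.relInterior M B).Nonempty → FrameField.IsClosedIn M S) :
    FrameField.Redundant M S f P ∧ ∃ C : Set (FrameField.E 3), C ⊆ B ∧
      FrameField.RedundantVia M S f P C := by
  obtain ⟨e⟩ := hB.nonempty_ballParam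
  suffices h : ∃ C ⊆ B, FrameField.RedundantVia M S f P C from
    ⟨⟨h.choose, h.choose_spec.2⟩, h⟩
  rcases (frontier B ∩ S ∩ FrameField.relInterior M B).eq_empty_or_nonempty with
    hempty | ⟨y₀, hy₀, hy₀R⟩
  · exact ⟨B, le_rfl, e.redundantVia_of_inter_eq_empty hf hBM hsing hPB hempty⟩
  · by_cases hal : FrameField.BoundaryAligned M (M \ S) f
    · exact e.exists_redundantVia_of_isClosedIn hf hBM hsing hPS hPB hy₀
        (hclosed hal ⟨y₀, hy₀, hy₀R⟩)
    · exact ⟨B, le_rfl, e.redundantVia_of_not_boundaryAligned hf hBM hsing hPB hy₀ hy₀R hal⟩
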